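/- Let $S^3=\{(u,v)\in\mathbb C^2 : |u|^2+|v|^2=1\}$, oriented as the boundary of the unit ball of $\mathbb C^2=\mathbb R^4$ (outward normal first, real coordinates $(\mathrm{Re}\,u,\mathrm{Im}\,u,\mathrm{Re}\,v,\mathrm{Im}\,v)$), let $D^2\subset\mathbb C$ be the closed unit disk, and let $L\subset S^3$ be the image of $S^1\to S^3$, $z\mapsto(z,0)$. Let $n\neq0$ be an integer and $\epsilon>0$. Put $$j(z,w)=\frac{1}{\sqrt{1+|\epsilon w|^2}}\,(z,\epsilon w z^n),\qquad (z,w)\in S^1\times D^2,\qquad U=j(S^1\times D^2).$$ This is a smooth embedding onto a closed tubular neighborhood $U$ of $L$ which sends $S^1\times\{0\}$ to $L$ and $S^1\times\{1\}$ to a knot whose linking number with $L$ is $n$. The surgery on $L$ with framing $n$ is the closed connected 3-manifold $$S^3_{(L,n)}=\bigl((S^3-\mathrm{int}\,U)\sqcup (D^2\times S^1)\bigr)/(x\sim j(x),\ x\in S^1\times S^1).$$ Regard $S^3-L$ as the dense open subset of $S^3_{(L,n)}$ that is the complement of $\{0\}\times S^1\subset D^2\times S^1$: a point of $S^3-\mathrm{int}\,U$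 is regarded as its class, and $j(z,tw)$, for $z,w\in S^1$ and $0<t\le1$, as the class of $(tz,w)\in D^2\times S^1$. Let $S^3_{(L,n)}$ carry the orientation that extends the one of $S^3-U$. Let $\mathbb Z_{|n|}$ act on $S^3$ by multiplication with the $|n|$-th roots of unity, and let the lens space $S^3/\mathbb Z_{|n|}$ carry the orientation inherited from $S^3$. Then the map $$i_n:\ S^3-L\to (S^3-L)/\mathbb Z_{|n|},\qquad (u,v)\mapsto\Bigl(\frac v{|v|}\Bigr)^{-1/n}(u,|v|)$$ is independent of the choice of the $n$-th root, and it extends uniquely to a homeomorphism from $S^3_{(L,n)}$ onto $S^3/\mathbb Z_{|n|}$. The degree of this homeomorphism is $-\mathrm{sign}(n)$. In particular, for $n=-2$, the map $i_{-2}$ extends uniquely to a homeomorphism from $S^3_{(L,-2)}$ onto $\mathbb RP^3=S^3/\{\pm1\}$, and this homeomorphism has degree one. -/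

import Mathlib

open scoped Manifold ContDiff Topology

noncomputable section

namespace UnknotSurgery

/-! ### The 3-sphere, its orientation, the unknot -/

/-- Euclidean 3-space, the model space for charts. -/
abbrev E3 : Type := EuclideanSpace ℝ (Fin 3)

/-- The unit sphere of `ℂ²`. -/
def S3 : Set (ℂ × ℂ) := {p | ‖p.1‖ ^ 2 + ‖p.2‖ ^ 2 = 1}

/-- The closed unit disk in `ℂ`. -/
abbrev D2 : Type := Metric.closedBall (0 : ℂ) 1

/-- The unknot: the image of `z ↦ (z, 0)`, `S¹ → S³`. -/
def unknot : Set (ℂ × ℂ) := Set.range fun z : Circle => ((z : ℂ), (0 : ℂ))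

/-- The identification `(x₁ + i y₁, x₂ + i y₂) ↦ (x₁, y₁, x₂, y₂)` of `ℂ²` with `ℝ⁴`. -/
def realCoords (p : ℂ × ℂ) : Fin 4 → ℝ := ![p.1.re, p.1.im, p.2.re, p.2.im]

/-- The determinant of `(p, b₁, b₂, b₃)` in `ℂ² = ℝ⁴`. At a point `p` of the sphere the vector `p`
is the outward normal, so (outward normal first) a basis `b₁, b₂, b₃` of the tangent space at `p` is
positively oriented if and only if this number is positive. -/
def orientationDet (p b₁ b₂ b₃ : ℂ × ℂ) : ℝ :=
  Matrix.det (Matrix.of ![realCoords p, realCoords b₁, realCoords b₂, realCoords b₃])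

theorem snd_ne_zero (p : ↥(S3 \ unknot)) : p.1.2 ≠ 0 := by
  intro h
  apply p.2.2
  have h1 : ‖p.1.1‖ ^ 2 + ‖p.1.2‖ ^ 2 = 1 := p.2.1
  rw [h] at h1
  have h2 : ‖p.1.1‖ = 1 := by
    have : ‖p.1.1‖ ^ 2 = 1 := by simpa using h1
    nlinarith [norm_nonneg p.1.1]
  refine ⟨⟨p.1.1, by simp [Submonoid.unitSphere, h2]⟩, ?_⟩
  exact Prod.ext rfl h.symm

/-! ### Oriented manifolds and the degree of a map -/

section Degree

variable {M N : Type*} [TopologicalSpace M] [TopologicalSpace N]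

/-- `A` is an oriented smooth atlas that makes `M` a closed connected oriented 3-manifold. -/
structure IsClosedOrientedManifold (A : Set (OpenPartialHomeomorph M E3)) : Prop where
  compact : CompactSpace M
  hausdorff : T2Space M
  connected : ConnectedSpace M
  cover : ∀ x : M, ∃ e ∈ A, x ∈ e.source
  smooth : ∀ e ∈ A, ∀ e' ∈ A, ContDiffOn ℝ ∞ (e' ∘ e.symm) (e.symm.trans e').source
  oriented : ∀ e ∈ A, ∀ e' ∈ A, ∀ y ∈ (e.symm.trans e').source,
    0 < (fderiv ℝ (e' ∘ e.symm) y).det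

/-- `f` is smooth in the charts of `A` and `B`. -/
def IsSmoothMap (A : Set (OpenPartialHomeomorph M E3)) (B : Set (OpenPartialHomeomorph N E3))
    (f : C(M, N)) : Prop :=
  ∀ e ∈ A, ∀ e' ∈ B,
    ContDiffOn ℝ ∞ (e' ∘ f ∘ e.symm) (e.target ∩ e.symm ⁻¹' (f ⁻¹' e'.source))

/-- The Jacobian determinant of `f` at `x`, read in the charts `e` and `e'`. -/
def jacobian (e : OpenPartialHomeomorph M E3) (e' : OpenPartialHomeomorph N E3) (f : C(M, N))
    (x : M) : ℝ :=
  (fderiv ℝ (e' ∘ f ∘ e.symm) (e x)).det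

/-- `y` is a regular value of `f`. -/
def IsRegularValue (A : Set (OpenPartialHomeomorph M E3)) (B : Set (OpenPartialHomeomorph N E3))
    (f : C(M, N)) (y : N) : Prop :=
  ∀ x : M, f x = y → ∀ e ∈ A, ∀ e' ∈ B, x ∈ e.source → y ∈ e'.source → jacobian e e' f x ≠ 0

open Classical in
/-- The sign (`1`, `-1` or `0`) of the Jacobian determinant of `f` at `x` in oriented charts. -/
def localSign (A : Set (OpenPartialHomeomorph M E3)) (B : Set (OpenPartialHomeomorph N E3))
    (f : C(M, N)) (x : M) : ℤ :=
  if ∃ e ∈ A, ∃ e' ∈ B, x ∈ e.source ∧ f x ∈ e'.source ∧ 0 < jacobian e e' f x then 1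
  else if ∃ e ∈ A, ∃ e' ∈ B, x ∈ e.source ∧ f x ∈ e'.source ∧ jacobian e e' f x < 0 then -1
  else 0

/-- The continuous map `f` between closed connected oriented manifolds has degree `d`: it is
homotopic to a smooth map `g` such that, for every regular value `y` of `g`, the points of
`g⁻¹(y)`, counted with the sign of the Jacobian, add up to `d`. -/
def HasDegree (A : Set (OpenPartialHomeomorph M E3)) (B : Set (OpenPartialHomeomorph N E3))
    (f : C(M, N)) (d : ℤ) : Prop :=
  ∃ g : C(M, N), f.Homotopic g ∧ IsSmoothMap A B g ∧ (∃ y, IsRegularValue A B g y) ∧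
    ∀ y, IsRegularValue A B g y → ∑ᶠ x ∈ g ⁻¹' {y}, localSign A B g x = d

/-- `φ` is a smooth local lift of the parametrization `e.symm` of `M` through the map
`π : X → M`, taking the value `x` at the point of `E3` that corresponds to `π x`. Here `X` is
regarded as a subset of `ℂ²` by means of `ι`. -/
def IsSmoothLiftAt {X : Type*} (ι : X → ℂ × ℂ) (π : X → M) (e : OpenPartialHomeomorph M E3)
    (x : X) (φ : E3 → ℂ × ℂ) : Prop :=
  ContDiffAt ℝ ∞ φ (e (π x)) ∧ φ (e (π x)) = ι x ∧
    ∀ᶠ y in 𝓝 (e (π x)), ∃ x' : X, ι x' = φ y ∧ π x' = e.symm y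

/-- At `y`, the map `φ` is a positively oriented local parametrization of the 3-sphere. -/
def IsPositiveAt (φ : E3 → ℂ × ℂ) (y : E3) : Prop :=
  0 < orientationDet (φ y) (fderiv ℝ φ y (EuclideanSpace.single 0 1))
    (fderiv ℝ φ y (EuclideanSpace.single 1 1)) (fderiv ℝ φ y (EuclideanSpace.single 2 1))

end Degree

/-! ### Linking numbers and surgery -/

/-- The velocity at `z` of a closed curve parametrized by the circle. -/
def velocity (γ : Circle → S3) (z : Circle) : ℂ × ℂ :=
  deriv (fun θ : ℝ => (γ (z * Circle.exp θ) : ℂ × ℂ)) 0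

/-- The disjoint oriented closed curves `γ`, `γ'` in the 3-sphere have linking number `m`: there is
a smooth map `F` of the closed disk to the sphere with boundary curve `γ`, transverse to `γ'`,
whose algebraic number of intersections with `γ'` is `m`. -/
def HasLinkingNumber (γ γ' : Circle → S3) (m : ℤ) : Prop :=
  (∀ z w, γ z ≠ γ' w) ∧
  ∃ (F : ℂ → ℂ × ℂ) (V : Set ℂ), IsOpen V ∧ Metric.closedBall 0 1 ⊆ V ∧ ContDiffOn ℝ ∞ F V ∧
    (∀ a ∈ Metric.closedBall (0 : ℂ) 1, F a ∈ S3) ∧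
    (∀ z : Circle, F z = γ z) ∧
    (∀ a ∈ Metric.closedBall (0 : ℂ) 1, ∀ z : Circle, F a = γ' z →
      orientationDet (F a) (fderiv ℝ F a 1) (fderiv ℝ F a Complex.I) (velocity γ' z) ≠ 0) ∧
    ∑ᶠ x ∈ {x : ℂ × Circle | x.1 ∈ Metric.closedBall (0 : ℂ) 1 ∧ F x.1 = γ' x.2},
      ((SignType.sign (orientationDet (F x.1) (fderiv ℝ F x.1 1) (fderiv ℝ F x.1 Complex.I)
        (velocity γ' x.2)) : SignType) : ℤ) = m

/-- The inclusion of the circle as the boundary of the disk. -/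
def toDisk (z : Circle) : D2 := ⟨(z : ℂ), by rw [mem_closedBall_zero_iff, Circle.norm_coe]⟩

/-- The center of the disk. -/
def center : D2 := ⟨0, by simp⟩

/-- `j` is a smooth embedding of `S¹ × D²` onto a closed tubular neighborhood of the knot `L`, it
sends `S¹ × {0}` to `L`, and it sends `S¹ × {1}` to a knot whose linking number with `L` is `n`. -/
structure IsFramedTube (L : Set (ℂ × ℂ)) (n : ℤ) (j : Circle × D2 → S3) : Prop where
  embedding : Topology.IsEmbedding j
  smooth : ∃ (J : ℂ × ℂ → ℂ × ℂ) (V : Set (ℂ × ℂ)), IsOpen V ∧ ContDiffOn ℝ ∞ J V ∧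
    ∀ (z : Circle) (w : D2), ((z : ℂ), (w : ℂ)) ∈ V ∧ J ((z : ℂ), (w : ℂ)) = j (z, w) ∧
      ∀ (a : ℝ) (b : ℂ), fderiv ℝ J ((z : ℂ), (w : ℂ)) (a * Complex.I * z, b) = 0 →
        a = 0 ∧ b = 0
  core : Set.range (fun z : Circle => (j (z, center) : ℂ × ℂ)) = L
  neighborhood : ∀ p : S3, (p : ℂ × ℂ) ∈ L → p ∈ interior (Set.range j)
  linking : HasLinkingNumber (fun z => j (z, center)) (fun z => j (z, toDisk 1)) n

/-- The gluing relation of surgery: a point of `S¹ × S¹`, regarded as a boundary point of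
`D² × S¹`, is identified with its image under `j`. -/
def gluing (j : Circle × D2 → S3) :
    {p : S3 // p ∉ interior (Set.range j)} ⊕ (D2 × Circle) →
    {p : S3 // p ∉ interior (Set.range j)} ⊕ (D2 × Circle) → Prop :=
  fun a b => ∃ (p : {p : S3 // p ∉ interior (Set.range j)}) (z w : Circle),
    a = Sum.inl p ∧ b = Sum.inr (toDisk z, w) ∧ p.1 = j (z, toDisk w)

/-- The result of the surgery along `j`: the complement of the interior of the image of `j` is
glued to `D² × S¹` along `S¹ × S¹` via `j`. -/
abbrev Surgery (j : Circle × D2 → S3) : Type := Quot (gluing j)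

/-! ### The surgery on the unknot with framing `n` -/

/-- The embedding `j(z, w) = (1 + |εw|²)^(-1/2) (z, ε w zⁿ)` of `S¹ × D²`. -/
def tube (ε : ℝ) (n : ℤ) (x : Circle × D2) : S3 :=
  ⟨((1 / √(1 + ‖(ε : ℂ) * (x.2 : ℂ)‖ ^ 2) : ℝ) : ℂ) •
      ((x.1 : ℂ), (ε : ℂ) * (x.2 : ℂ) * (x.1 : ℂ) ^ n), by
    have h : (0 : ℝ) < 1 + ‖(ε : ℂ) * (x.2 : ℂ)‖ ^ 2 := by positivity
    have h2 := Real.sq_sqrt h.le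
    have h3 := Real.sqrt_pos.2 h
    simp only [S3, Set.mem_ofPred_eq, Prod.smul_fst, Prod.smul_snd, smul_eq_mul, norm_mul,
      Complex.norm_real, norm_zpow, Circle.norm_coe, one_zpow, mul_one, Real.norm_eq_abs, mul_pow,
      sq_abs] at h h2 h3 ⊢
    rw [one_div, inv_pow, h2]
    field_simp⟩

theorem norm_snd_le_of_mem_range {ε : ℝ} {n : ℤ} {p : S3} (h : p ∈ Set.range (tube ε n)) :
    p.1.1 ≠ 0 ∧ ‖p.1.2‖ ≤ |ε| * ‖p.1.1‖ := by
  obtain ⟨⟨z, w⟩, rfl⟩ := h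
  have h : (0 : ℝ) < 1 + ‖(ε : ℂ) * (w : ℂ)‖ ^ 2 := by positivity
  have h3 := Real.sqrt_pos.2 h
  have hw : ‖(w : ℂ)‖ ≤ 1 := mem_closedBall_zero_iff.1 w.2
  constructor
  · simp only [tube, Prod.smul_fst, smul_eq_mul]
    refine mul_ne_zero ?_ (Circle.coe_ne_zero z)
    exact_mod_cast (one_div_pos.2 h3).ne'
  · simp only [tube, Prod.smul_fst, Prod.smul_snd, smul_eq_mul, norm_mul, norm_zpow, Circle.norm_coe,
      one_zpow, mul_one, Complex.norm_real, Real.norm_eq_abs]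
    exact le_of_le_of_eq (mul_le_mul_of_nonneg_left
      (mul_le_of_le_one_right (abs_nonneg ε) hw) (abs_nonneg _)) (mul_comm _ _)

/-- `v / |v|` as a point of the circle. -/
def unitPart (v : ℂ) (hv : v ≠ 0) : Circle :=
  ⟨v / (‖v‖ : ℂ), by simp [Submonoid.unitSphere, hv]⟩

open Classical in
/-- The complement of the unknot as a subset of the surgered manifold: outside the interior of the
tube it is the identity, and inside the tube the point `j(z, t w)` with `|z| = |w| = 1`, `0 < t < 1`
is regarded as the point `(t z, w)` of `D² × S¹`. -/
def complementInclusion (ε : ℝ) (n : ℤ) (p : ↥(S3 \ unknot)) : Surgery (tube ε n) :=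
  if h : (⟨p.1, p.2.1⟩ : S3) ∈ interior (Set.range (tube ε n)) then
    have hu := norm_snd_le_of_mem_range (interior_subset h)
    Quot.mk _ (Sum.inr
      (⟨((‖p.1.2‖ / (ε * ‖p.1.1‖) : ℝ) : ℂ) * (unitPart p.1.1 hu.1 : ℂ), by
          rw [mem_closedBall_zero_iff, norm_mul, Circle.norm_coe, mul_one, Complex.norm_real,
            norm_div, norm_mul, norm_norm, norm_norm, Real.norm_eq_abs]
          exact div_le_one_of_le₀ hu.2 (by positivity)⟩,
        unitPart p.1.2 (snd_ne_zero p) * unitPart p.1.1 hu.1 ^ (-n)))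
  else Quot.mk _ (Sum.inl ⟨⟨p.1, p.2.1⟩, h⟩)

/-- The oriented smooth charts of the surgered manifold: those that are smooth and positively
oriented on the complement of the unknot, with the orientation of the 3-sphere, and smooth on the
interior of `D² × S¹`. -/
def surgeryAtlas (ε : ℝ) (n : ℤ) : Set (OpenPartialHomeomorph (Surgery (tube ε n)) E3) :=
  {e | (∀ p : ↥(S3 \ unknot), complementInclusion ε n p ∈ e.source →
          ∃ φ, IsSmoothLiftAt Subtype.val (complementInclusion ε n) e p φ ∧
            IsPositiveAt φ (e (complementInclusion ε n p))) ∧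
       ∀ x : D2 × Circle, ‖(x.1 : ℂ)‖ < 1 → Quot.mk _ (Sum.inr x) ∈ e.source →
          ∃ φ, IsSmoothLiftAt (fun x : D2 × Circle => ((x.1 : ℂ), (x.2 : ℂ)))
              (fun x => Quot.mk _ (Sum.inr x)) e x φ ∧
            Function.Injective (fderiv ℝ φ (e (Quot.mk _ (Sum.inr x))))}

/-! ### Lens spaces, projective space, and the map `i_n` -/

/-- The generator `ζ = exp(2πi/|n|)` of the group of `|n|`-th roots of unity. -/
def zeta (n : ℤ) : ℂ := Complex.exp (2 * Real.pi * Complex.I / (|n| : ℤ))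

theorem zeta_ne_zero (n : ℤ) : zeta n ≠ 0 := Complex.exp_ne_zero _

/-- Points of the 3-sphere in the same orbit of the action of `ℤ/|n|` generated by
`(u, v) ↦ (ζu, ζv)`. -/
def lensSetoid (n : ℤ) : Setoid S3 where
  r p q := ∃ k : ℤ, q.1 = zeta n ^ k • p.1
  iseqv :=
    { refl := fun p => ⟨0, by simp⟩
      symm := by
        rintro p q ⟨k, h⟩
        refine ⟨-k, ?_⟩
        rw [h, smul_smul, ← zpow_add₀ (zeta_ne_zero n)]
        simp
      trans := by
        rintro p q r ⟨k, h⟩ ⟨l, h'⟩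
        refine ⟨l + k, ?_⟩
        rw [h', h, smul_smul, ← zpow_add₀ (zeta_ne_zero n)] }

/-- Antipodal points of the 3-sphere. -/
def antipodalSetoid : Setoid S3 where
  r p q := q.1 = p.1 ∨ q.1 = -p.1
  iseqv :=
    { refl := fun p => Or.inl rfl
      symm := by
        rintro p q (h | h)
        · exact Or.inl h.symm
        · exact Or.inr (by rw [h, neg_neg])
      trans := by
        rintro p q r (h | h) (h' | h') <;> rw [h'] <;> simp [h] }

/-- The lens space `S³ / ℤ_{|n|}`. -/
abbrev Lens (n : ℤ) : Type := Quotient (lensSetoid n)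

/-- Real projective 3-space. -/
abbrev RP3 : Type := Quotient antipodalSetoid

/-- The oriented smooth charts that a quotient of the 3-sphere inherits from the sphere. -/
def quotientAtlas (s : Setoid S3) : Set (OpenPartialHomeomorph (Quotient s) E3) :=
  {e | ∀ p : S3, Quotient.mk s p ∈ e.source →
    ∃ φ, IsSmoothLiftAt Subtype.val (Quotient.mk s) e p φ ∧ IsPositiveAt φ (e (Quotient.mk s p))}

/-- `(v/|v|)^(-1/n) (u, |v|)`, with the principal branch of the root. -/
def rootMap (n : ℤ) (p : ↥(S3 \ unknot)) : S3 :=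
  ⟨((p.1.2 / (‖p.1.2‖ : ℂ)) ^ (-1 / (n : ℂ))) • (p.1.1, (‖p.1.2‖ : ℂ)), by
    have h0 : (‖p.1.2‖ : ℝ) ≠ 0 := norm_ne_zero_iff.2 (snd_ne_zero p)
    have h1 : p.1.2 / (‖p.1.2‖ : ℂ) ≠ 0 :=
      div_ne_zero (snd_ne_zero p) (by exact_mod_cast h0)
    have h2 : ‖p.1.2 / (‖p.1.2‖ : ℂ)‖ = 1 := by
      rw [norm_div, Complex.norm_real, norm_norm, div_self h0]
    have h3 : (-1 / (n : ℂ)) = ((-1 / (n : ℝ) : ℝ) : ℂ) := by push_cast; rfl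
    have h4 : ‖(p.1.2 / (‖p.1.2‖ : ℂ)) ^ (-1 / (n : ℂ))‖ = 1 := by
      rw [Complex.norm_cpow_of_ne_zero h1, h2, h3]
      simp only [Complex.ofReal_re, Complex.ofReal_im, Real.one_rpow]
      simp
    have h5 : ‖p.1.1‖ ^ 2 + ‖p.1.2‖ ^ 2 = 1 := p.2.1
    simpa only [S3, Set.mem_ofPred_eq, Prod.smul_fst, Prod.smul_snd, smul_eq_mul, norm_mul, h4,
      one_mul, Complex.norm_real, norm_norm] using h5⟩

/-- The map `i_n` from the complement of the unknot to the lens space. -/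
def iMap (n : ℤ) (p : ↥(S3 \ unknot)) : Lens n := Quotient.mk (lensSetoid n) (rootMap n p)

end UnknotSurgery

end

open UnknotSurgery

/-!
Write `v = |v| e` with `|e| = 1`. On `v ≠ 0` the map `i_n` has the inverse induced by
`rootInv n : (u, v) ↦ (u e⁻¹, |v| e⁻ⁿ)`. In the coordinates of the solid torus `D² × S¹` that is
glued in, this inverse reads `coreInv ε n : (u, v) ↦ (conj (v / u) / ε, f⁻ⁿ)` with `u = |u| f`,
which also makes sense for `v = 0`. The two formulas together present the surgered manifold as the
quotient of `S³` by the `|n|`-th roots of unity.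

The maps `rootInv n` and `coreInv ε n` are smooth, so the charts of the surgered manifold are the
maps that lift to smooth parametrizations of `S³`. A shear between two pairs of rotations has the
Jacobian of `rootInv n`, which is therefore `-n`: the orientation of `S³ - U` is the one of `S³`
multiplied by `-sign n`, whereas the lens space has the orientation of `S³` itself.

The framing curve meets the hemisphere `{(a, s) : s ≥ 0}` bounded by `L` exactly at `zⁿ = 1`, each
time with the sign of `n`.
-/

noncomputable section

namespace UnknotSurgery

open scoped Manifold ContDiff Topology

/-! ### Orientation determinants -/

/-- The real coordinates as a linear equivalence of `ℂ²` with `ℝ⁴`, which turns statements about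
`orientationDet` into statements about rows of matrices. -/
def realCoordsEquiv : (ℂ × ℂ) ≃ₗ[ℝ] (Fin 4 → ℝ) where
  toFun := realCoords
  map_add' p q := by
    ext i
    fin_cases i <;> simp [realCoords]
  map_smul' c p := by
    ext i
    fin_cases i <;> simp [realCoords]
  invFun x := (⟨x 0, x 1⟩, ⟨x 2, x 3⟩)
  left_inv _ := rfl
  right_inv x := by
    ext i
    fin_cases i <;> rfl

theorem orientationDet_ne_zero_iff (p b₁ b₂ b₃ : ℂ × ℂ) :
    orientationDet p b₁ b₂ b₃ ≠ 0 ↔ LinearIndependent ℝ ![p, b₁, b₂, b₃] := by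
  have rows : (Matrix.of ![realCoords p, realCoords b₁, realCoords b₂, realCoords b₃]).row =
      realCoordsEquiv ∘ ![p, b₁, b₂, b₃] := by
    ext i
    fin_cases i <;> rfl
  rw [orientationDet, ← isUnit_iff_ne_zero, ← Matrix.isUnit_iff_isUnit_det,
    ← Matrix.linearIndependent_rows_iff_isUnit, rows]
  exact realCoordsEquiv.toLinearMap.linearIndependent_iff realCoordsEquiv.ker

theorem orientationDet_apply (p a b c : ℂ × ℂ) : orientationDet p a b c =
    p.1.re * (a.1.im * (b.2.re * c.2.im - b.2.im * c.2.re)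
      - a.2.re * (b.1.im * c.2.im - b.2.im * c.1.im)
      + a.2.im * (b.1.im * c.2.re - b.2.re * c.1.im))
    - p.1.im * (a.1.re * (b.2.re * c.2.im - b.2.im * c.2.re)
      - a.2.re * (b.1.re * c.2.im - b.2.im * c.1.re)
      + a.2.im * (b.1.re * c.2.re - b.2.re * c.1.re))
    + p.2.re * (a.1.re * (b.1.im * c.2.im - b.2.im * c.1.im)
      - a.1.im * (b.1.re * c.2.im - b.2.im * c.1.re)
      + a.2.im * (b.1.re * c.1.im - b.1.im * c.1.re))
    - p.2.im * (a.1.re * (b.1.im * c.2.re - b.2.re * c.1.im)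
      - a.1.im * (b.1.re * c.2.re - b.2.re * c.1.re)
      + a.2.re * (b.1.re * c.1.im - b.1.im * c.1.re)) := by
  rw [orientationDet, Matrix.det_succ_row_zero]
  simp only [Fin.sum_univ_four, Matrix.det_fin_three, realCoords, Matrix.submatrix_apply,
    Matrix.of_apply, Matrix.cons_val, Fin.succAbove, Fin.isValue, Fin.reduceSucc,
    Fin.reduceCastSucc, Fin.reduceLT, Fin.coe_ofNat_eq_mod, reduceIte]
  ring

/-- The orientation determinant of the frame at `p` formed by the images under `T` of the standard
basis vectors of `E3`. -/
def frameDet (p : ℂ × ℂ) (T : E3 → ℂ × ℂ) : ℝ :=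
  orientationDet p (T (EuclideanSpace.single 0 1)) (T (EuclideanSpace.single 1 1))
    (T (EuclideanSpace.single 2 1))

/-- The determinant whose sign decides whether a local parametrization of the sphere is positively
oriented. -/
def paramDet (φ : E3 → ℂ × ℂ) (y : E3) : ℝ := frameDet (φ y) (fderiv ℝ φ y)

theorem isPositiveAt_iff_paramDet_pos {φ : E3 → ℂ × ℂ} {y : E3} :
    IsPositiveAt φ y ↔ 0 < paramDet φ y :=
  Iff.rfl

theorem frameDet_prodMap_mul (c d : ℂ) (p : ℂ × ℂ) (T : E3 → ℂ × ℂ) :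
    frameDet (c * p.1, d * p.2) (fun x => (c * (T x).1, d * (T x).2)) =
      ‖c‖ ^ 2 * ‖d‖ ^ 2 * frameDet p T := by
  simp only [frameDet, orientationDet_apply, ← Complex.normSq_eq_norm_sq, Complex.normSq_apply,
    Complex.mul_re, Complex.mul_im]
  ring

theorem frameDet_smul {c : ℂ} (hc : ‖c‖ = 1) (p : ℂ × ℂ) (T : E3 → ℂ × ℂ) :
    frameDet (c • p) (fun x => c • T x) = frameDet p T := by
  have := frameDet_prodMap_mul c c p T
  rwa [hc, one_pow, one_mul, one_mul] at this

theorem frameDet_real_smul_add (c : ℝ) (l : E3 → ℝ) (w : ℂ × ℂ) (T : E3 → ℂ × ℂ) :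
    frameDet (c • w) (fun x => c • T x + l x • w) = c ^ 4 * frameDet w T := by
  simp only [frameDet, orientationDet_apply, Prod.fst_add, Prod.snd_add, Prod.smul_fst,
    Prod.smul_snd, Complex.add_re, Complex.add_im, Complex.real_smul, Complex.re_ofReal_mul,
    Complex.im_ofReal_mul]
  ring

theorem frameDet_shear (s : ℂ) (m : ℝ) (p : ℂ × ℂ) (T : E3 → ℂ × ℂ) :
    frameDet (p.1 - s * (p.2.im : ℂ), ⟨p.2.re, m * p.2.im⟩)
      (fun x => ((T x).1 - s * ((T x).2.im : ℂ), ⟨(T x).2.re, m * (T x).2.im⟩)) =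
      m * frameDet p T := by
  simp only [frameDet, orientationDet_apply, Complex.sub_re, Complex.sub_im,
    Complex.re_mul_ofReal, Complex.im_mul_ofReal]
  ring

theorem map_eq_sum_single {ι F : Type*} [Fintype ι] [DecidableEq ι] [AddCommGroup F] [Module ℝ F]
    (T : EuclideanSpace ℝ ι →ₗ[ℝ] F) (x : EuclideanSpace ℝ ι) :
    T x = ∑ i, x i • T (EuclideanSpace.single i 1) := by
  conv_lhs => rw [← (EuclideanSpace.basisFun ι ℝ).sum_repr x]
  simp only [map_sum, map_smul, EuclideanSpace.basisFun_repr, EuclideanSpace.basisFun_apply]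

theorem det_eq_det_single {ι : Type*} [Fintype ι] [DecidableEq ι]
    (A : EuclideanSpace ℝ ι →L[ℝ] EuclideanSpace ℝ ι) :
    A.det = Matrix.det (Matrix.of fun i j => A (EuclideanSpace.single j 1) i) := by
  rw [ContinuousLinearMap.det, ← LinearMap.det_toMatrix (EuclideanSpace.basisFun ι ℝ).toBasis]
  congr 1

theorem frameDet_comp (p : ℂ × ℂ) (T : E3 →L[ℝ] ℂ × ℂ) (A : E3 →L[ℝ] E3) :
    frameDet p (T.comp A) = A.det * frameDet p T := by
  have image_basis : ∀ i, T.comp A (EuclideanSpace.single i 1) =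
      ∑ j, A (EuclideanSpace.single i 1) j • T (EuclideanSpace.single j 1) :=
    fun i => map_eq_sum_single (T : E3 →ₗ[ℝ] ℂ × ℂ) (A (EuclideanSpace.single i 1))
  simp only [frameDet, image_basis, Fin.sum_univ_three, det_eq_det_single, Matrix.det_fin_three,
    Matrix.of_apply, orientationDet_apply, Prod.fst_add, Prod.snd_add, Prod.smul_fst,
    Prod.smul_snd, Complex.add_re, Complex.add_im, Complex.real_smul, Complex.re_ofReal_mul,
    Complex.im_ofReal_mul]
  ring

theorem frameDet_add_map (p : ℂ × ℂ) (T : E3 →L[ℝ] ℂ × ℂ) (y : E3) :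
    frameDet (p + T y) T = frameDet p T := by
  rw [show T y = _ from map_eq_sum_single (T : E3 →ₗ[ℝ] ℂ × ℂ) y]
  simp only [frameDet, orientationDet_apply, Fin.sum_univ_three, ContinuousLinearMap.coe_coe,
    Prod.fst_add, Prod.snd_add, Prod.smul_fst, Prod.smul_snd, Complex.add_re, Complex.add_im,
    Complex.real_smul, Complex.re_ofReal_mul, Complex.im_ofReal_mul]
  ring

theorem frameDet_ne_zero_iff (p : ℂ × ℂ) (T : E3 →L[ℝ] ℂ × ℂ) :
    frameDet p T ≠ 0 ↔ ∀ (l : ℝ) (x : E3), l • p + T x = 0 → l = 0 ∧ x = 0 := by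
  have combination : ∀ (l : ℝ) (x : E3), l • p + T x =
      ∑ i, ![l, x 0, x 1, x 2] i • ![p, T (EuclideanSpace.single 0 1),
        T (EuclideanSpace.single 1 1), T (EuclideanSpace.single 2 1)] i := by
    intro l x
    rw [show T x = _ from map_eq_sum_single (T : E3 →ₗ[ℝ] ℂ × ℂ) x]
    simp [Fin.sum_univ_succ]
  rw [frameDet, orientationDet_ne_zero_iff, Fintype.linearIndependent_iff]
  constructor
  · intro h l x hlx
    have coeff := h _ ((combination l x).symm.trans hlx)
    refine ⟨coeff 0, ?_⟩
    ext i
    fin_cases i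
    exacts [coeff 1, coeff 2, coeff 3]
  · intro h g hg
    have coefficients : ![g 0, g 1, g 2, g 3] = g := by
      ext i
      fin_cases i <;> rfl
    have := h (g 0) !₂[g 1, g 2, g 3] ((combination _ _).trans (by rw [← hg, ← coefficients]; rfl))
    have coords := fun i => congrArg (fun x : E3 => x i) this.2
    intro i
    fin_cases i
    exacts [this.1, coords 0, coords 1, coords 2]

theorem paramDet_comp {φ φ' : E3 → ℂ × ℂ} {τ : E3 → E3} {y : E3}
    (hφ' : DifferentiableAt ℝ φ' (τ y)) (hτ : DifferentiableAt ℝ τ y)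
    (heq : φ =ᶠ[𝓝 y] φ' ∘ τ) :
    paramDet φ y = (fderiv ℝ τ y).det * paramDet φ' (τ y) := by
  rw [paramDet, paramDet, heq.fderiv_eq, fderiv_comp y hφ' hτ, frameDet_comp, heq.self_of_nhds]
  rfl

theorem paramDet_real_smul {c : E3 → ℝ} {w : E3 → ℂ × ℂ} {y : E3} (hc : DifferentiableAt ℝ c y)
    (hw : DifferentiableAt ℝ w y) : paramDet (fun z => c z • w z) y = c y ^ 4 * paramDet w y := by
  rw [paramDet, fderiv_fun_smul hc hw, paramDet, ← frameDet_real_smul_add (c y) (fderiv ℝ c y)]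
  rfl

theorem paramDet_const_smul {c : ℂ} (hc : ‖c‖ = 1) {w : E3 → ℂ × ℂ} {y : E3}
    (hw : DifferentiableAt ℝ w y) : paramDet (fun z => c • w z) y = paramDet w y := by
  rw [paramDet, fderiv_fun_const_smul hw, paramDet, ← frameDet_smul hc (w y)]
  rfl

theorem injective_fderiv_of_paramDet_ne_zero {φ : E3 → ℂ × ℂ} {y : E3} (h : paramDet φ y ≠ 0) :
    Function.Injective (fderiv ℝ φ y) := by
  rw [injective_iff_map_eq_zero]
  intro x hx
  exact ((frameDet_ne_zero_iff _ _).1 h 0 x (by rw [hx, zero_smul, add_zero])).2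

theorem continuousAt_paramDet {φ : E3 → ℂ × ℂ} {y : E3} (h : ContDiffAt ℝ 1 φ y) :
    ContinuousAt (paramDet φ) y := by
  have hφ : ContinuousAt φ y := h.continuousAt
  have hφ' : ∀ v, ContinuousAt (fun z => fderiv ℝ φ z v) y :=
    fun v => (h.continuousAt_fderiv one_ne_zero).clm_apply continuousAt_const
  unfold paramDet frameDet
  simp only [orientationDet_apply]
  fun_prop

/-! ### Lifts through immersions and through finite groups of scalars -/

theorem contDiffAt_of_eventuallyEq_comp {𝕜 E F G : Type*} [RCLike 𝕜]
    [NormedAddCommGroup E] [NormedSpace 𝕜 E] [CompleteSpace E]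
    [NormedAddCommGroup F] [NormedSpace 𝕜 F] [NormedAddCommGroup G] [NormedSpace 𝕜 G]
    {m : WithTop ℕ∞} (hm : m ≠ 0) {φ : G → F} {φ' : E → F} {τ : G → E} {y : G}
    (hφ : ContDiffAt 𝕜 m φ y) (hφ' : ContDiffAt 𝕜 m φ' (τ y)) (hτ : ContinuousAt τ y)
    (himm : (fderiv 𝕜 φ' (τ y)).HasLeftInverse) (heq : φ =ᶠ[𝓝 y] φ' ∘ τ) :
    ContDiffAt 𝕜 m τ y := by
  obtain ⟨L, hL⟩ := himm
  -- `L ∘ φ'` has derivative `1` at `τ y`, so it has a local inverse, and `τ` is that inverse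
  -- after `L ∘ φ`.
  have smooth : ContDiffAt 𝕜 m (L ∘ φ') (τ y) := L.contDiff.contDiffAt.comp _ hφ'
  have deriv_id : HasFDerivAt (L ∘ φ') (ContinuousLinearEquiv.refl 𝕜 E : E →L[𝕜] E) (τ y) := by
    convert L.hasFDerivAt.comp (τ y) (hφ'.differentiableAt hm).hasFDerivAt using 1
    exact ContinuousLinearMap.ext fun x => (hL x).symm
  have left_inverse : τ =ᶠ[𝓝 y] smooth.localInverse deriv_id hm ∘ L ∘ φ := by
    filter_upwards [hτ.eventually
      (smooth.hasStrictFDerivAt' deriv_id hm).eventually_left_inverse, heq] with z hz hφz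
    rw [Function.comp_apply, Function.comp_apply, hφz]
    exact hz.symm
  refine ContDiffAt.congr_of_eventuallyEq ?_ left_inverse
  refine ContDiffAt.comp y ?_ (L.contDiff.contDiffAt.comp _ hφ)
  rw [Function.comp_apply, heq.self_of_nhds]
  exact smooth.to_localInverse deriv_id hm

section FiniteScalars

variable {X 𝕜 E : Type*} [TopologicalSpace X] [DivisionRing 𝕜] [AddCommGroup E] [Module 𝕜 E]
  [TopologicalSpace E] [T2Space E] [ContinuousConstSMul 𝕜 E] {S : Set 𝕜} {φ ψ : X → E} {x : X}

theorem eventually_eq_smul_imp_eq (hS : S.Finite) (hφ : ContinuousAt φ x) (hψ : ContinuousAt ψ x)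
    (heq : ψ x = φ x) (hne : φ x ≠ 0) :
    ∀ᶠ y in 𝓝 x, (∃ c ∈ S, ψ y = c • φ y) → ψ y = φ y := by
  have only_one : ∀ᶠ y in 𝓝 x, ∀ c ∈ S, ψ y = c • φ y → c = 1 := by
    rw [hS.eventually_all]
    intro c _
    by_cases hc : c = 1
    · exact .of_forall fun _ _ => hc
    · have hx : ψ x ≠ c • φ x := by
        rw [heq]
        exact fun h => hc (smul_left_injective 𝕜 hne (h.symm.trans (one_smul 𝕜 _).symm))
      filter_upwards [(hψ.ne_iff_eventually_ne (hφ.const_smul c)).1 hx] with y hy h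
      exact absurd h hy
  filter_upwards [only_one] with y hy ⟨c, hcS, hc⟩
  rw [hc, hy c hcS hc, one_smul]

theorem eventuallyEq_of_eventually_eq_smul (hS : S.Finite) (hφ : ContinuousAt φ x)
    (hψ : ContinuousAt ψ x) (heq : ψ x = φ x) (hne : φ x ≠ 0)
    (h : ∀ᶠ y in 𝓝 x, ∃ c ∈ S, ψ y = c • φ y) : ψ =ᶠ[𝓝 x] φ := by
  filter_upwards [h, eventually_eq_smul_imp_eq hS hφ hψ heq hne] with y hy hy' using hy' hy

end FiniteScalars

/-! ### Radial projection to the sphere -/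

/-- The Euclidean norm on `ℂ²`; the norm of the type `ℂ × ℂ` is the maximum norm. -/
def euclNorm (w : ℂ × ℂ) : ℝ := √(‖w.1‖ ^ 2 + ‖w.2‖ ^ 2)

theorem euclNorm_pos {w : ℂ × ℂ} (hw : w ≠ 0) : 0 < euclNorm w := by
  apply Real.sqrt_pos.2
  by_cases h : w.1 = 0
  · have : w.2 ≠ 0 := fun h' => hw (Prod.ext h h')
    positivity
  · positivity

theorem mem_S3_iff {w : ℂ × ℂ} : w ∈ S3 ↔ euclNorm w = 1 := by
  rw [euclNorm, Real.sqrt_eq_one]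
  rfl

theorem ne_zero_of_mem_S3 {w : ℂ × ℂ} (hw : w ∈ S3) : w ≠ 0 := by
  rintro rfl
  simp [S3] at hw

theorem euclNorm_smul (c : ℂ) (w : ℂ × ℂ) : euclNorm (c • w) = ‖c‖ * euclNorm w := by
  simp only [euclNorm, Prod.smul_fst, Prod.smul_snd, smul_eq_mul, norm_mul, mul_pow, ← mul_add]
  rw [Real.sqrt_mul (by positivity), Real.sqrt_sq (norm_nonneg c)]

theorem euclNorm_real_smul (c : ℝ) (w : ℂ × ℂ) : euclNorm (c • w) = |c| * euclNorm w := by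
  have := euclNorm_smul (c : ℂ) w
  rwa [Complex.norm_real, Real.norm_eq_abs, Complex.coe_smul] at this

theorem smul_mem_S3 {c : ℂ} (hc : ‖c‖ = 1) {w : ℂ × ℂ} (hw : w ∈ S3) : c • w ∈ S3 := by
  rw [mem_S3_iff] at hw ⊢
  rw [euclNorm_smul, hc, hw, one_mul]

theorem contDiffAt_inv_euclNorm {w : ℂ × ℂ} (hw : w ≠ 0) :
    ContDiffAt ℝ ∞ (fun w => (euclNorm w)⁻¹) w := by
  refine ContDiffAt.inv (ContDiffAt.sqrt ?_ (Real.sqrt_pos.1 (euclNorm_pos hw)).ne')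
    (euclNorm_pos hw).ne'
  exact ((contDiff_norm_sq ℝ).comp contDiff_fst).contDiffAt.add
    ((contDiff_norm_sq ℝ).comp contDiff_snd).contDiffAt

/-- The radial projection of `ℂ²` minus the origin to the sphere, with value `0` at the origin. -/
def radialProj (w : ℂ × ℂ) : ℂ × ℂ := (euclNorm w)⁻¹ • w

theorem radialProj_mem_S3 {w : ℂ × ℂ} (hw : w ≠ 0) : radialProj w ∈ S3 := by
  rw [mem_S3_iff, radialProj, euclNorm_real_smul, abs_of_pos (inv_pos.2 (euclNorm_pos hw)),
    inv_mul_cancel₀ (euclNorm_pos hw).ne']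

theorem radialProj_of_mem_S3 {w : ℂ × ℂ} (hw : w ∈ S3) : radialProj w = w := by
  rw [radialProj, mem_S3_iff.1 hw, inv_one, one_smul]

theorem radialProj_real_smul {t : ℝ} (ht : 0 < t) (w : ℂ × ℂ) :
    radialProj (t • w) = radialProj w := by
  rw [radialProj, radialProj, euclNorm_real_smul, abs_of_pos ht, smul_smul, mul_inv, mul_right_comm,
    inv_mul_cancel₀ ht.ne', one_mul]

theorem contDiffAt_radialProj {w : ℂ × ℂ} (hw : w ≠ 0) : ContDiffAt ℝ ∞ radialProj w :=
  (contDiffAt_inv_euclNorm hw).smul contDiffAt_id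

theorem isCompact_S3 : IsCompact S3 := by
  refine Metric.isCompact_of_isClosed_isBounded ?_ ?_
  · exact isClosed_eq (by fun_prop) continuous_const
  · refine (Metric.isBounded_closedBall (x := (0 : ℂ × ℂ)) (r := 1)).subset fun w hw => ?_
    have sum_sq : ‖w.1‖ ^ 2 + ‖w.2‖ ^ 2 = 1 := hw
    rw [mem_closedBall_zero_iff, Prod.norm_def, sup_le_iff]
    constructor <;> nlinarith [norm_nonneg w.1, norm_nonneg w.2]

instance : CompactSpace S3 := isCompact_iff_compactSpace.1 isCompact_S3

theorem isConnected_S3 : IsConnected S3 := by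
  have connected_compl : IsConnected ({0}ᶜ : Set (ℂ × ℂ)) := by
    refine isConnected_compl_singleton_of_one_lt_rank ?_ 0
    rw [rank_prod', Complex.rank_real_complex]
    norm_num
  have image_eq : radialProj '' {0}ᶜ = S3 :=
    Set.Subset.antisymm (Set.image_subset_iff.2 fun w hw => radialProj_mem_S3 hw)
      fun w hw => ⟨w, ne_zero_of_mem_S3 hw, radialProj_of_mem_S3 hw⟩
  rw [← image_eq]
  exact connected_compl.image _ fun w hw =>
    (contDiffAt_radialProj hw).continuousAt.continuousWithinAt

instance : ConnectedSpace S3 := isConnected_iff_connectedSpace.1 isConnected_S3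

/-! ### Quotients of the sphere by finitely many scalars -/

/-- `π` exhibits `M` as the orbit space of the sphere under multiplication with the scalars in the
finite set `G`. That `G` is a group is not recorded, since `eq_iff` makes the orbits a partition. -/
structure IsFiniteScalarQuotient {M : Type*} [TopologicalSpace M] (G : Set ℂ) (π : S3 → M) :
    Prop where
  finite : G.Finite
  continuous : Continuous π
  isOpenMap : IsOpenMap π
  surjective : Function.Surjective π
  eq_iff : ∀ p q : S3, π p = π q ↔ ∃ c ∈ G, q.1 = c • p.1

/-- The smooth charts of `M` that have the orientation of the sphere multiplied by the sign
of `σ`. -/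
def orientedAtlas {M : Type*} [TopologicalSpace M] (π : S3 → M) (σ : ℝ) :
    Set (OpenPartialHomeomorph M E3) :=
  {e | ∀ p : S3, π p ∈ e.source →
    ∃ φ, IsSmoothLiftAt Subtype.val π e p φ ∧ 0 < σ * paramDet φ (e (π p))}

theorem norm_eq_one_of_smul_mem_S3 {c : ℂ} {w : ℂ × ℂ} (hw : w ∈ S3) (hcw : c • w ∈ S3) :
    ‖c‖ = 1 := by
  rw [mem_S3_iff] at hw hcw
  rwa [euclNorm_smul, hw, mul_one] at hcw

namespace IsFiniteScalarQuotient

variable {M N : Type*} [TopologicalSpace M] [TopologicalSpace N] {G : Set ℂ} {π : S3 → M}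
  {ρ : S3 → N}

theorem compactSpace (h : IsFiniteScalarQuotient G π) : CompactSpace M := by
  have := isCompact_range h.continuous
  rw [h.surjective.range_eq] at this
  exact ⟨this⟩

theorem connectedSpace (h : IsFiniteScalarQuotient G π) : ConnectedSpace M :=
  h.surjective.connectedSpace h.continuous

theorem t2Space (h : IsFiniteScalarQuotient G π) : T2Space M := by
  have fibers : {q : S3 × S3 | π q.1 = π q.2} = ⋃ c ∈ G, {q : S3 × S3 | q.2.1 = c • q.1.1} := by
    ext q
    simp [h.eq_iff]
  rw [t2Space_iff_of_isOpenQuotientMap ⟨h.surjective, h.continuous, h.isOpenMap⟩, fibers]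
  exact h.finite.isClosed_biUnion fun c _ => isClosed_eq (by fun_prop) (by fun_prop)

theorem exists_isOpen_injOn (h : IsFiniteScalarQuotient G π) (p : S3) :
    ∃ U, IsOpen U ∧ p ∈ U ∧ Set.InjOn π U := by
  have eventually_eq : ∀ᶠ z in 𝓝 (p, p), (∃ c ∈ G, z.2.1 = c • z.1.1) → z.2.1 = z.1.1 :=
    eventually_eq_smul_imp_eq h.finite (by fun_prop) (by fun_prop) rfl (ne_zero_of_mem_S3 p.2)
  rw [nhds_prod_eq] at eventually_eq
  obtain ⟨U, hU, inj⟩ := Filter.eventually_prod_self_iff'.1 eventually_eq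
  refine ⟨interior U, isOpen_interior, mem_interior_iff_mem_nhds.2 hU, fun x hx y hy hxy => ?_⟩
  exact Subtype.ext
    (inj x (interior_subset hx) y (interior_subset hy) ((h.eq_iff x y).1 hxy)).symm

theorem lift_eventuallyEq (h : IsFiniteScalarQuotient G π) {X : Type*} [TopologicalSpace X] {x : X}
    {φ ψ : X → ℂ × ℂ} {s : X → M} (hφ : ContinuousAt φ x) (hψ : ContinuousAt ψ x) (heq : φ x = ψ x)
    (φ_lifts : ∀ᶠ y in 𝓝 x, ∃ p : S3, p.1 = φ y ∧ π p = s y)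
    (ψ_lifts : ∀ᶠ y in 𝓝 x, ∃ p : S3, p.1 = ψ y ∧ π p = s y) : φ =ᶠ[𝓝 x] ψ := by
  obtain ⟨p, hp, _⟩ := ψ_lifts.self_of_nhds
  refine eventuallyEq_of_eventually_eq_smul h.finite hψ hφ heq (hp ▸ ne_zero_of_mem_S3 p.2) ?_
  filter_upwards [φ_lifts, ψ_lifts] with y ⟨p, hp, hpy⟩ ⟨p', hp', hpy'⟩
  obtain ⟨c, hc, hcp⟩ := (h.eq_iff p' p).1 (hpy'.trans hpy.symm)
  exact ⟨c, hc, by rw [← hp, hcp, hp']⟩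

section Coordinates

variable {f : M → N} {e : OpenPartialHomeomorph M E3} {e' : OpenPartialHomeomorph N E3} {q : S3}
  {φ φ' : E3 → ℂ × ℂ}

theorem continuousAt_coordinates (hf : Continuous f) {x : M} (hx : x ∈ e.source)
    (hx' : f x ∈ e'.source) : ContinuousAt (e' ∘ f ∘ e.symm) (e x) := by
  have he : ContinuousAt (f ∘ e.symm) (e x) :=
    hf.continuousAt.comp (e.continuousAt_symm (e.map_source hx))
  refine ContinuousAt.comp ?_ he
  rw [Function.comp_apply, e.left_inv hx]
  exact e'.continuousAt hx'

theorem lift_eventuallyEq_comp (hρ : IsFiniteScalarQuotient G ρ) (hf : Continuous f)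
    (hfπ : ∀ q, f (π q) = ρ q) (hq : π q ∈ e.source) (hq' : ρ q ∈ e'.source)
    (hφ : IsSmoothLiftAt Subtype.val π e q φ) (hφ' : IsSmoothLiftAt Subtype.val ρ e' q φ') :
    φ =ᶠ[𝓝 (e (π q))] φ' ∘ e' ∘ f ∘ e.symm := by
  obtain ⟨φ_smooth, φ_at, φ_lifts⟩ := hφ
  obtain ⟨φ'_smooth, φ'_at, φ'_lifts⟩ := hφ'
  have image_q : (e' ∘ f ∘ e.symm) (e (π q)) = e' (ρ q) := by
    rw [Function.comp_apply, Function.comp_apply, e.left_inv hq, hfπ]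
  have tendsto_f : Filter.Tendsto (f ∘ e.symm) (𝓝 (e (π q))) (𝓝 (ρ q)) := by
    rw [← hfπ]
    exact hf.continuousAt.tendsto.comp (e.tendsto_symm hq)
  have tendsto_coordinates : Filter.Tendsto (e' ∘ f ∘ e.symm) (𝓝 (e (π q))) (𝓝 (e' (ρ q))) :=
    (e'.continuousAt hq').tendsto.comp tendsto_f
  refine hρ.lift_eventuallyEq (s := f ∘ e.symm) φ_smooth.continuousAt ?_ ?_ ?_ ?_
  · exact ContinuousAt.comp (by rw [image_q]; exact φ'_smooth.continuousAt)
      (by rwa [← image_q] at tendsto_coordinates)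
  · rw [φ_at, Function.comp_apply, image_q, φ'_at]
  · filter_upwards [φ_lifts] with y ⟨p, hp, hpy⟩
    exact ⟨p, hp, by rw [← hfπ, hpy]; rfl⟩
  · filter_upwards [tendsto_coordinates.eventually φ'_lifts,
      tendsto_f.eventually (e'.open_source.mem_nhds hq')] with y ⟨p', hp', hpy'⟩ hy
    exact ⟨p', hp', hpy'.trans (e'.left_inv hy)⟩

variable {σ σ' : ℝ}

theorem contDiffAt_and_det_pos (hρ : IsFiniteScalarQuotient G ρ) (hf : Continuous f)
    (hfπ : ∀ q, f (π q) = ρ q) (he : e ∈ orientedAtlas π σ) (he' : e' ∈ orientedAtlas ρ σ')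
    (hq : π q ∈ e.source) (hq' : ρ q ∈ e'.source) :
    ContDiffAt ℝ ∞ (e' ∘ f ∘ e.symm) (e (π q)) ∧
      0 < σ * σ' * (fderiv ℝ (e' ∘ f ∘ e.symm) (e (π q))).det := by
  obtain ⟨φ, hφ, φ_sign⟩ := he q hq
  obtain ⟨φ', hφ', φ'_sign⟩ := he' q hq'
  have heq := hρ.lift_eventuallyEq_comp hf hfπ hq hq' hφ hφ'
  have image_q : e' (ρ q) = (e' ∘ f ∘ e.symm) (e (π q)) := by
    rw [Function.comp_apply, Function.comp_apply, e.left_inv hq, hfπ]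
  have φ'_smooth := hφ'.1
  rw [image_q] at φ'_smooth φ'_sign
  have φ'_immersion := injective_fderiv_of_paramDet_ne_zero (right_ne_zero_of_mul φ'_sign.ne')
  have smooth : ContDiffAt ℝ ∞ (e' ∘ f ∘ e.symm) (e (π q)) :=
    contDiffAt_of_eventuallyEq_comp (by simp) hφ.1 φ'_smooth
      (continuousAt_coordinates hf hq (by rwa [hfπ]))
      (.of_injective_of_finiteDimensional φ'_immersion) heq
  refine ⟨smooth, ?_⟩
  rw [paramDet_comp (φ'_smooth.differentiableAt (by simp)) (smooth.differentiableAt (by simp)) heq]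
    at φ_sign
  have sq_pos := pow_pos (abs_pos.2 (right_ne_zero_of_mul φ'_sign.ne')) 2
  rw [sq_abs] at sq_pos
  refine pos_of_mul_pos_left ?_ sq_pos.le
  calc 0 < _ := mul_pos φ_sign φ'_sign
    _ = _ := by ring

end Coordinates

end IsFiniteScalarQuotient

/-! ### Charts from the radial projection of affine hyperplanes -/

theorem apply_one_ne_zero (Λ : (ℝ × E3) ≃L[ℝ] ℂ × ℂ) (y : E3) : Λ (1, y) ≠ 0 := fun h =>
  one_ne_zero (congrArg Prod.fst ((map_eq_zero_iff Λ Λ.injective).1 h) : (1 : ℝ) = 0)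

/-- The inverse chart of the sphere which projects the affine hyperplane `{Λ (1, y)}` of `ℂ²`
radially to the sphere. -/
def radialParam (Λ : (ℝ × E3) ≃L[ℝ] ℂ × ℂ) (y : E3) : S3 :=
  ⟨radialProj (Λ (1, y)), radialProj_mem_S3 (apply_one_ne_zero Λ y)⟩

section RadialParam

variable (Λ : (ℝ × E3) ≃L[ℝ] ℂ × ℂ)

theorem contDiff_radialParam : ContDiff ℝ ∞ fun y => (radialParam Λ y : ℂ × ℂ) :=
  contDiff_iff_contDiffAt.2 fun y => ContDiffAt.comp (g := radialProj) y
    (contDiffAt_radialProj (apply_one_ne_zero Λ y)) (by fun_prop)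

theorem continuous_radialParam : Continuous (radialParam Λ) :=
  (contDiff_radialParam Λ).continuous.subtype_mk _

theorem paramDet_radialParam (y : E3) : paramDet (fun z => (radialParam Λ z : ℂ × ℂ)) y =
    (euclNorm (Λ (1, y)))⁻¹ ^ 4 * frameDet (Λ (1, 0)) (fun x => Λ (0, x)) := by
  let T : E3 →L[ℝ] ℂ × ℂ := (Λ : (ℝ × E3) →L[ℝ] ℂ × ℂ).comp (.inr ℝ ℝ E3)
  have affine : ∀ z, Λ (1, z) = Λ (1, 0) + T z := fun z => by
    change _ = Λ (1, 0) + Λ (0, z)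
    rw [← map_add, Prod.mk_add_mk, add_zero, zero_add]
  have deriv_affine : fderiv ℝ (fun z => Λ (1, z)) y = T := by
    rw [funext affine, fderiv_const_add, T.fderiv]
  have scale_diff : DifferentiableAt ℝ (fun z => (euclNorm (Λ (1, z)))⁻¹) y :=
    DifferentiableAt.comp (g := fun w => (euclNorm w)⁻¹) y
      ((contDiffAt_inv_euclNorm (apply_one_ne_zero Λ y)).differentiableAt (by simp)) (by fun_prop)
  change paramDet (fun z => (euclNorm (Λ (1, z)))⁻¹ • Λ (1, z)) y = _
  rw [paramDet_real_smul scale_diff (by fun_prop), paramDet, deriv_affine, affine,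
    frameDet_add_map]
  rfl

theorem symm_radialParam (y : E3) :
    Λ.symm (radialParam Λ y) = (euclNorm (Λ (1, y)))⁻¹ • (1, y) := by
  rw [ContinuousLinearEquiv.symm_apply_eq, map_smul]
  rfl

theorem injective_radialParam : Function.Injective (radialParam Λ) := by
  intro y z hyz
  have coords := congrArg (fun q : S3 => Λ.symm q) hyz
  simp only [symm_radialParam, Prod.smul_mk, Prod.mk.injEq, smul_eq_mul, mul_one] at coords
  obtain ⟨scale, vector⟩ := coords
  rw [scale] at vector
  exact smul_right_injective E3 (inv_pos.2 (euclNorm_pos (apply_one_ne_zero Λ z))).ne' vector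

theorem radialParam_symm {q : S3} (hq : 0 < (Λ.symm q).1) :
    radialParam Λ ((Λ.symm q).1⁻¹ • (Λ.symm q).2) = q := by
  have on_ray : Λ (1, (Λ.symm q).1⁻¹ • (Λ.symm q).2) = (Λ.symm q).1⁻¹ • q.1 := by
    rw [eq_comm, ← Λ.symm_apply_eq, map_smul]
    exact Prod.ext (inv_mul_cancel₀ hq.ne') rfl
  refine Subtype.ext ?_
  change radialProj _ = _
  rw [on_ray, radialProj_real_smul (inv_pos.2 hq), radialProj_of_mem_S3 q.2]

theorem isOpenMap_radialParam : IsOpenMap (radialParam Λ) := by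
  intro U hU
  have continuous_height : Continuous fun q : S3 => (Λ.symm q.1).1 := by fun_prop
  have continuous_horizontal : Continuous fun q : S3 => (Λ.symm q.1).2 := by fun_prop
  have image_eq : radialParam Λ '' U = {q : S3 | 0 < (Λ.symm q.1).1} ∩
      (fun q : S3 => (Λ.symm q.1).1⁻¹ • (Λ.symm q.1).2) ⁻¹' U := by
    ext q
    constructor
    · rintro ⟨y, hy, rfl⟩
      have scale_pos := inv_pos.2 (euclNorm_pos (apply_one_ne_zero Λ y))
      simp only [Set.mem_inter_iff, Set.mem_ofPred_eq, Set.mem_preimage, symm_radialParam,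
        Prod.smul_mk, smul_eq_mul, mul_one, smul_smul, inv_mul_cancel₀ scale_pos.ne', one_smul]
      exact ⟨scale_pos, hy⟩
    · rintro ⟨hq, hqU⟩
      exact ⟨_, hqU, radialParam_symm Λ hq⟩
  rw [image_eq]
  refine ContinuousOn.isOpen_inter_preimage ?_ (isOpen_lt continuous_const continuous_height) hU
  exact (continuous_height.continuousOn.inv₀ fun q hq => ne_of_gt hq).smul
    continuous_horizontal.continuousOn

end RadialParam

theorem exists_frame {p : ℂ × ℂ} (hp : p ∈ S3) {σ : ℝ} (hσ : σ ≠ 0) :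
    ∃ Λ : (ℝ × E3) ≃L[ℝ] ℂ × ℂ, Λ (1, 0) = p ∧ frameDet p (fun x => Λ (0, x)) = σ := by
  -- With `p = (u, v)`, the vectors `i p`, `(-v̄, ū)`, `i (-v̄, ū)` are an orthonormal basis of the
  -- tangent space.
  let T : E3 →ₗ[ℝ] ℂ × ℂ :=
    (LinearMap.toSpanSingleton ℝ (ℂ × ℂ) (Complex.I • p)).comp (EuclideanSpace.projₗ 0) +
      (LinearMap.toSpanSingleton ℝ (ℂ × ℂ) (-star p.2, star p.1)).comp (EuclideanSpace.projₗ 1) +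
      (LinearMap.toSpanSingleton ℝ (ℂ × ℂ) (σ • Complex.I • (-star p.2, star p.1))).comp
        (EuclideanSpace.projₗ 2)
  have det_T : frameDet p T.toContinuousLinearMap = σ := by
    have norm_p : p.1.re * p.1.re + p.1.im * p.1.im + (p.2.re * p.2.re + p.2.im * p.2.im) = 1 := by
      simp only [← Complex.normSq_apply, Complex.normSq_eq_norm_sq]
      exact hp
    simp only [frameDet, orientationDet_apply, T, RCLike.star_def, Prod.smul_mk, smul_eq_mul,
      mul_neg, smul_neg, Complex.real_smul, add_apply, LinearMap.coe_toContinuousLinearMap',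
      LinearMap.coe_comp, Function.comp_apply, PiLp.projₗ_apply, PiLp.single_apply,
      LinearMap.toSpanSingleton_apply, reduceIte, Fin.reduceEq, one_smul, zero_smul, map_add,
      add_zero, zero_add, Complex.mul_re, Complex.mul_im, Complex.neg_re, Complex.neg_im,
      Complex.I_re, Complex.I_im, Complex.conj_re, Complex.conj_im, Complex.ofReal_re,
      Complex.ofReal_im, Prod.smul_fst, Prod.smul_snd]
    linear_combination σ * (p.1.re * p.1.re + p.1.im * p.1.im +
      (p.2.re * p.2.re + p.2.im * p.2.im) + 1) * norm_p
  let L : (ℝ × E3) →ₗ[ℝ] ℂ × ℂ := (LinearMap.toSpanSingleton ℝ (ℂ × ℂ) p).coprod T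
  have injective_L : Function.Injective L := by
    rw [injective_iff_map_eq_zero]
    rintro ⟨l, x⟩ hx
    exact Prod.ext_iff.2
      ((frameDet_ne_zero_iff p T.toContinuousLinearMap).1 (det_T.symm ▸ hσ) l x hx)
  refine ⟨(LinearEquiv.ofInjectiveOfFinrankEq L injective_L (by simp)).toContinuousLinearEquiv,
    ?_, ?_⟩
  · change (1 : ℝ) • p + T 0 = p
    rw [map_zero, add_zero, one_smul]
  · have restrict : (fun x => (0 : ℝ) • p + T x) = T := by simp
    change frameDet p (fun x => (0 : ℝ) • p + T x) = σ
    rw [restrict]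
    exact det_T

namespace IsFiniteScalarQuotient

variable {M : Type*} [TopologicalSpace M] {G : Set ℂ} {π : S3 → M} {σ : ℝ}

theorem mem_orientedAtlas (h : IsFiniteScalarQuotient G π) {e : OpenPartialHomeomorph M E3}
    {P : E3 → S3} (hP : ContDiff ℝ ∞ fun y => (P y : ℂ × ℂ))
    (hdet : ∀ y, 0 < σ * paramDet (fun z => (P z : ℂ × ℂ)) y)
    (he : ∀ y ∈ e.target, π (P y) = e.symm y) : e ∈ orientedAtlas π σ := by
  intro q hq
  obtain ⟨c, hc, hcq⟩ := (h.eq_iff (P (e (π q))) q).1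
    ((he _ (e.map_source hq)).trans (e.left_inv hq))
  have norm_c : ‖c‖ = 1 := norm_eq_one_of_smul_mem_S3 (P (e (π q))).2 (hcq ▸ q.2)
  refine ⟨fun z => c • (P z).1, ⟨hP.contDiffAt.const_smul c, hcq.symm, ?_⟩, ?_⟩
  · filter_upwards [e.open_target.mem_nhds (e.map_source hq)] with z hz
    exact ⟨⟨_, smul_mem_S3 norm_c (P z).2⟩, rfl,
      ((h.eq_iff _ _).2 ⟨c, hc, rfl⟩).symm.trans (he z hz)⟩
  · rw [paramDet_const_smul norm_c (hP.contDiffAt.differentiableAt (by simp))]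
    exact hdet _

theorem exists_chart (h : IsFiniteScalarQuotient G π) (hσ : σ ≠ 0) (p : S3) :
    ∃ e ∈ orientedAtlas π σ, π p ∈ e.source := by
  obtain ⟨Λ, Λ_at, Λ_det⟩ := exists_frame p.2 hσ
  obtain ⟨U, hU, hpU, injOn_π⟩ := h.exists_isOpen_injOn p
  have radialParam_zero : radialParam Λ 0 = p := Subtype.ext (by
    change radialProj (Λ (1, 0)) = p
    rw [Λ_at, radialProj_of_mem_S3 p.2])
  have injOn : Set.InjOn (π ∘ radialParam Λ) (radialParam Λ ⁻¹' U) :=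
    injOn_π.comp (injective_radialParam Λ).injOn fun _ hy => hy
  let e := OpenPartialHomeomorph.ofContinuousOpen (injOn.toPartialEquiv _ _)
    (h.continuous.comp (continuous_radialParam Λ)).continuousOn
    (h.isOpenMap.comp (isOpenMap_radialParam Λ)) (hU.preimage (continuous_radialParam Λ))
  refine ⟨e.symm, h.mem_orientedAtlas (contDiff_radialParam Λ) ?_ fun _ _ => rfl, ?_⟩
  · intro y
    rw [paramDet_radialParam, Λ_at, Λ_det, mul_left_comm]
    exact mul_pos (pow_pos (inv_pos.2 (euclNorm_pos (apply_one_ne_zero Λ y))) 4)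
      (mul_self_pos.2 hσ)
  · exact ⟨0, by rwa [Set.mem_preimage, radialParam_zero], congrArg π radialParam_zero⟩

theorem isClosedOrientedManifold (h : IsFiniteScalarQuotient G π) (hσ : σ ≠ 0) :
    IsClosedOrientedManifold (orientedAtlas π σ) := by
  have transition : ∀ e ∈ orientedAtlas π σ, ∀ e' ∈ orientedAtlas π σ,
      ∀ y ∈ (e.symm.trans e').source, ContDiffAt ℝ ∞ (e' ∘ e.symm) y ∧
        0 < σ * σ * (fderiv ℝ (e' ∘ e.symm) y).det := by
    intro e he e' he' y hy
    rw [OpenPartialHomeomorph.trans_source] at hy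
    obtain ⟨q, hq⟩ := h.surjective (e.symm y)
    have source : π q ∈ e.source := hq ▸ e.map_target hy.1
    have := h.contDiffAt_and_det_pos (f := id) continuous_id (fun _ => rfl) he he' source
      (hq ▸ hy.2)
    rwa [hq, e.right_inv hy.1] at this
  exact
    { compact := h.compactSpace
      hausdorff := h.t2Space
      connected := h.connectedSpace
      cover := fun x => by
        obtain ⟨p, rfl⟩ := h.surjective x
        exact h.exists_chart hσ p
      smooth := fun e he e' he' y hy => (transition e he e' he' y hy).1.contDiffWithinAt
      oriented := fun e he e' he' y hy =>
        pos_of_mul_pos_right (transition e he e' he' y hy).2 (mul_self_nonneg σ) }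

end IsFiniteScalarQuotient

/-! ### The degree of a homeomorphism -/

section Degree

variable {M N : Type*} [TopologicalSpace M] [TopologicalSpace N]
  {A : Set (OpenPartialHomeomorph M E3)} {B : Set (OpenPartialHomeomorph N E3)} {s : ℝ}

theorem localSign_eq_sign {f : C(M, N)} {x : M}
    (hs : ∀ e ∈ A, ∀ e' ∈ B, x ∈ e.source → f x ∈ e'.source → 0 < s * jacobian e e' f x)
    (hA : ∃ e ∈ A, x ∈ e.source) (hB : ∃ e' ∈ B, f x ∈ e'.source) :
    localSign A B f x = ((SignType.sign s : SignType) : ℤ) := by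
  obtain ⟨e, he, hx⟩ := hA
  obtain ⟨e', he', hx'⟩ := hB
  have hee' := hs e he e' he' hx hx'
  rcases lt_trichotomy s 0 with neg | rfl | pos
  · rw [localSign, if_neg, if_pos, sign_neg neg]
    · rfl
    · exact ⟨e, he, e', he', hx, hx', neg_of_mul_pos_right hee' neg.le⟩
    · rintro ⟨e₁, he₁, e₁', he₁', hx₁, hx₁', pos₁⟩
      exact (mul_neg_of_neg_of_pos neg pos₁).not_gt (hs e₁ he₁ e₁' he₁' hx₁ hx₁')
  · simp at hee'
  · rw [localSign, if_pos, sign_pos pos]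
    · rfl
    · exact ⟨e, he, e', he', hx, hx', pos_of_mul_pos_right hee' pos.le⟩

theorem hasDegree_sign_of_homeomorph [Nonempty N] (Φ : M ≃ₜ N)
    (hA : ∀ x, ∃ e ∈ A, x ∈ e.source) (hB : ∀ y, ∃ e' ∈ B, y ∈ e'.source)
    (hsmooth : IsSmoothMap A B Φ) (hs : ∀ x, ∀ e ∈ A, ∀ e' ∈ B, x ∈ e.source → Φ x ∈ e'.source →
      0 < s * jacobian e e' (Φ : C(M, N)) x) :
    HasDegree A B Φ ((SignType.sign s : SignType) : ℤ) := by
  have regular : ∀ y, IsRegularValue A B Φ y := fun y x hxy e he e' he' hx hy =>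
    right_ne_zero_of_mul (hs x e he e' he' hx (hxy ▸ hy)).ne'
  refine ⟨Φ, .refl _, hsmooth, ⟨Classical.arbitrary N, regular _⟩, fun y _ => ?_⟩
  have fiber : (Φ : C(M, N)) ⁻¹' {y} = {Φ.symm y} := by
    ext x
    exact Φ.toEquiv.eq_symm_apply.symm
  rw [fiber, finsum_mem_singleton]
  exact localSign_eq_sign (hs _) (hA _) (hB _)

end Degree

theorem IsFiniteScalarQuotient.hasDegree {M N : Type*} [TopologicalSpace M] [TopologicalSpace N]
    {G H : Set ℂ} {π : S3 → M} {ρ : S3 → N} (hπ : IsFiniteScalarQuotient G π)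
    (hρ : IsFiniteScalarQuotient H ρ) (Φ : M ≃ₜ N) (hΦ : ∀ q, Φ (π q) = ρ q) {σ σ' : ℝ}
    (hσ : σ ≠ 0) (hσ' : σ' ≠ 0) :
    HasDegree (orientedAtlas π σ) (orientedAtlas ρ σ') Φ
      ((SignType.sign (σ * σ') : SignType) : ℤ) := by
  have : Nonempty N := ⟨ρ (Classical.arbitrary S3)⟩
  refine hasDegree_sign_of_homeomorph Φ (hπ.isClosedOrientedManifold hσ).cover
    (hρ.isClosedOrientedManifold hσ').cover ?_ ?_
  · rintro e he e' he' y ⟨hy, hy'⟩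
    obtain ⟨q, hq⟩ := hπ.surjective (e.symm y)
    have smooth := (hρ.contDiffAt_and_det_pos Φ.continuous hΦ he he' (hq ▸ e.map_target hy)
      (by rw [← hΦ, hq]; exact hy')).1
    rw [hq, e.right_inv hy] at smooth
    exact smooth.contDiffWithinAt
  · intro x e he e' he' hx hx'
    obtain ⟨q, rfl⟩ := hπ.surjective x
    exact (hρ.contDiffAt_and_det_pos Φ.continuous hΦ he he' hx (by rwa [← hΦ])).2

/-! ### Roots of unity and the lens space -/

theorem pow_natAbs_eq_one_iff {G₀ : Type*} [GroupWithZero G₀] {n : ℤ} {c : G₀} :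
    c ^ n.natAbs = 1 ↔ c ^ n = 1 := by
  rcases Int.natAbs_eq n with h | h
  · nth_rewrite 2 [h]
    rw [zpow_natCast]
  · nth_rewrite 2 [h]
    rw [zpow_neg, zpow_natCast, inv_eq_one]

theorem finite_setOf_zpow_eq_one {K : Type*} [Field K] {n : ℤ} (hn : n ≠ 0) :
    {c : K | c ^ n = 1}.Finite := by
  refine (Polynomial.nthRootsFinset n.natAbs (1 : K)).finite_toSet.subset fun c hc => ?_
  rw [Finset.mem_coe, Polynomial.mem_nthRootsFinset (Int.natAbs_pos.2 hn), pow_natAbs_eq_one_iff]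
  exact hc

theorem norm_eq_one_of_norm_zpow {K : Type*} [NormedDivisionRing K] {n : ℤ} (hn : n ≠ 0) {c : K}
    (hc : ‖c ^ n‖ = 1) : ‖c‖ = 1 := by
  rw [norm_zpow] at hc
  by_contra h
  exact hn ((zpow_eq_one_iff_right₀ (norm_nonneg c) h).1 hc)

theorem isPrimitiveRoot_zeta {n : ℤ} (hn : n ≠ 0) : IsPrimitiveRoot (zeta n) n.natAbs := by
  have := Complex.isPrimitiveRoot_exp n.natAbs (by simpa using hn)
  rw [zeta]
  convert this using 5
  rw [← Int.natCast_natAbs, Int.cast_natCast]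

theorem lensSetoid_iff {n : ℤ} (hn : n ≠ 0) {p q : S3} :
    lensSetoid n p q ↔ ∃ c : ℂ, c ^ n = 1 ∧ q.1 = c • p.1 := by
  constructor
  · rintro ⟨k, hk⟩
    refine ⟨zeta n ^ k, ?_, hk⟩
    rw [← zpow_mul, mul_comm, zpow_mul,
      pow_natAbs_eq_one_iff.1 (isPrimitiveRoot_zeta hn).pow_eq_one, one_zpow]
  · rintro ⟨c, hc, hq⟩
    have : NeZero n.natAbs := ⟨Int.natAbs_ne_zero.2 hn⟩
    obtain ⟨k, -, rfl⟩ :=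
      (isPrimitiveRoot_zeta hn).eq_pow_of_pow_eq_one (pow_natAbs_eq_one_iff.2 hc)
    exact ⟨k, by rwa [zpow_natCast]⟩

theorem isFiniteScalarQuotient_mk {s : Setoid S3} {G : Set ℂ} (hG : G.Finite)
    (hs : ∀ p q, s p q ↔ ∃ c ∈ G, q.1 = c • p.1) :
    IsFiniteScalarQuotient G (Quotient.mk s) where
  finite := hG
  continuous := continuous_quotient_mk'
  isOpenMap U hU := by
    have saturation : Quotient.mk s ⁻¹' (Quotient.mk s '' U) =
        ⋃ c : {c : ℂ // c ∈ G ∧ ‖c‖ = 1},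
          (fun q : S3 => (⟨c.1 • q.1, smul_mem_S3 c.2.2 q.2⟩ : S3)) ⁻¹' U := by
      ext q
      simp only [Set.mem_preimage, Set.mem_image, Set.mem_iUnion]
      constructor
      · rintro ⟨p, hp, hpq⟩
        obtain ⟨c, hc, hpc⟩ := (hs q p).1 (s.symm (Quotient.exact hpq))
        have norm_c : ‖c‖ = 1 := norm_eq_one_of_smul_mem_S3 q.2 (hpc ▸ p.2)
        refine ⟨⟨c, hc, norm_c⟩, ?_⟩
        convert hp
        exact hpc.symm
      · rintro ⟨c, hc⟩
        exact ⟨_, hc, Quotient.sound (s.symm ((hs q _).2 ⟨c.1, c.2.1, rfl⟩))⟩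
    rw [isOpen_coinduced (f := Quotient.mk s), saturation]
    exact isOpen_iUnion fun c => hU.preimage (by fun_prop)
  surjective := Quotient.mk_surjective
  eq_iff p q := Quotient.eq.trans (hs p q)

theorem isFiniteScalarQuotient_lens {n : ℤ} (hn : n ≠ 0) :
    IsFiniteScalarQuotient {c : ℂ | c ^ n = 1} (Quotient.mk (lensSetoid n)) :=
  isFiniteScalarQuotient_mk (finite_setOf_zpow_eq_one hn) fun _ _ => lensSetoid_iff hn

theorem lens_mk_eq_of_zpow_eq {n : ℤ} (hn : n ≠ 0) {c c' : ℂ} {q q' : S3} {x : ℂ × ℂ}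
    (hq : q.1 = c • x) (hq' : q'.1 = c' • x) (hc : c ^ n = c' ^ n) (hc0 : c ≠ 0) :
    Quotient.mk (lensSetoid n) q = Quotient.mk (lensSetoid n) q' := by
  refine Quotient.sound ((lensSetoid_iff hn).2 ⟨c' / c, ?_, ?_⟩)
  · rw [div_zpow, hc, div_self]
    exact hc ▸ zpow_ne_zero n hc0
  · rw [hq, hq', smul_smul, div_mul_cancel₀ _ hc0]

theorem antipodalSetoid_eq_lensSetoid : antipodalSetoid = lensSetoid (-2) := by
  refine Setoid.ext fun p q => ?_
  rw [lensSetoid_iff (by norm_num)]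
  simp only [zpow_neg, inv_eq_one, zpow_ofNat, sq_eq_one_iff, or_and_right, exists_or,
    exists_eq_left, one_smul, neg_smul]
  rfl

/-! ### Directions and branches of roots -/

/-- The unit complex number `z / |z|`, with the value `0` at `z = 0`. -/
def direction (z : ℂ) : ℂ := z / (‖z‖ : ℂ)

theorem norm_direction {z : ℂ} (hz : z ≠ 0) : ‖direction z‖ = 1 := by
  simp [direction, hz]

theorem direction_ne_zero {z : ℂ} (hz : z ≠ 0) : direction z ≠ 0 := by
  simp [direction, hz]

theorem norm_mul_direction (z : ℂ) : (‖z‖ : ℂ) * direction z = z := by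
  rcases eq_or_ne z 0 with rfl | hz
  · simp [direction]
  · exact mul_div_cancel₀ z (by simpa using hz)

theorem direction_mul (z w : ℂ) : direction (z * w) = direction z * direction w := by
  simp [direction, mul_div_mul_comm]

theorem direction_eq_self {z : ℂ} (hz : ‖z‖ = 1) : direction z = z := by simp [direction, hz]

theorem direction_ofReal {r : ℝ} (hr : 0 < r) : direction (r : ℂ) = 1 := by
  simp [direction, abs_of_pos hr, hr.ne']

theorem contDiffAt_ofReal_norm {z : ℂ} (hz : z ≠ 0) : ContDiffAt ℝ ∞ (fun z : ℂ => (‖z‖ : ℂ)) z :=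
  Complex.ofRealCLM.contDiff.contDiffAt.comp z (contDiffAt_norm ℝ hz)

theorem contDiffAt_direction {z : ℂ} (hz : z ≠ 0) : ContDiffAt ℝ ∞ direction z :=
  contDiffAt_id.mul ((contDiffAt_ofReal_norm hz).inv (by simpa using hz))

theorem contDiffAt_direction_zpow (n : ℤ) {z : ℂ} (hz : z ≠ 0) :
    ContDiffAt ℝ ∞ (fun z => direction z ^ n) z := by
  have zpow : ContDiffAt ℂ ∞ (fun w : ℂ => w ^ n) (direction z) :=
    (analyticAt_id.zpow (direction_ne_zero hz)).contDiffAt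
  exact (zpow.restrict_scalars ℝ).comp z (contDiffAt_direction hz)

/-- A branch of `x ↦ x ^ (-1 / n)` on the unit circle near `b ^ (-n)`, with the value `b` there. -/
def rootBranch (n : ℤ) (b x : ℂ) : ℂ := b * (x * b ^ n) ^ (-1 / (n : ℂ))

theorem rootBranch_zpow {n : ℤ} (hn : n ≠ 0) {b : ℂ} (hb : b ≠ 0) (x : ℂ) :
    rootBranch n b x ^ n = x⁻¹ := by
  rw [rootBranch, mul_zpow, ← Complex.cpow_mul_int, div_mul_cancel₀ _ (Int.cast_ne_zero.2 hn),
    Complex.cpow_neg_one, mul_inv, mul_left_comm, mul_inv_cancel₀ (zpow_ne_zero n hb), mul_one]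

theorem norm_rootBranch {n : ℤ} (hn : n ≠ 0) {b x : ℂ} (hb : b ≠ 0) (hx : ‖x‖ = 1) :
    ‖rootBranch n b x‖ = 1 :=
  norm_eq_one_of_norm_zpow hn (by rw [rootBranch_zpow hn hb, norm_inv, hx, inv_one])

theorem rootBranch_eq_self {n : ℤ} {b x : ℂ} (hx : b ^ n = x⁻¹) (hx0 : x ≠ 0) :
    rootBranch n b x = b := by
  rw [rootBranch, hx, mul_inv_cancel₀ hx0, Complex.one_cpow, mul_one]

theorem contDiffAt_rootBranch {n : ℤ} {b x : ℂ} (hx : b ^ n = x⁻¹) (hx0 : x ≠ 0) :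
    ContDiffAt ℝ ∞ (rootBranch n b) x := by
  have analytic : AnalyticAt ℂ (rootBranch n b) x := by
    refine analyticAt_const.mul (AnalyticAt.cpow (analyticAt_id.mul analyticAt_const)
      analyticAt_const ?_)
    simp only [hx, mul_inv_cancel₀ hx0]
    exact Complex.one_mem_slitPlane
  exact analytic.contDiffAt.restrict_scalars ℝ

theorem exists_zpow_eq_inv {n : ℤ} (hn : n ≠ 0) (x : ℂ) (hx : x ≠ 0) :
    ∃ b : ℂ, b ≠ 0 ∧ b ^ n = x⁻¹ := by
  have zpow := rootBranch_zpow hn one_ne_zero x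
  refine ⟨rootBranch n 1 x, fun h => inv_ne_zero hx ?_, zpow⟩
  rw [← zpow, h, zero_zpow n hn]

/-! ### The map `i_n` and its inverse -/

/-- The lift of `i_n` to the sphere which uses the branch `rootBranch n b` of the root. -/
def rootLift (n : ℤ) (b : ℂ) (p : ℂ × ℂ) : ℂ × ℂ :=
  rootBranch n b (direction p.2) • (p.1, (‖p.2‖ : ℂ))

/-- The inverse of `i_n`, lifted to the sphere. The formula uses that `c (u, |v|)` with
`c ^ n = (v / |v|)⁻¹` has second coordinate of direction `c`. -/
def rootInv (n : ℤ) (q : ℂ × ℂ) : ℂ × ℂ :=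
  (q.1 * (direction q.2)⁻¹, ‖q.2‖ * direction q.2 ^ (-n))

theorem rootMap_eq_rootLift (n : ℤ) (p : ↥(S3 \ unknot)) : (rootMap n p).1 = rootLift n 1 p := by
  simp [rootMap, rootLift, rootBranch, direction]

theorem norm_snd_mem_S3 {p : ℂ × ℂ} (hp : p ∈ S3) : (p.1, (‖p.2‖ : ℂ)) ∈ S3 := by
  simpa [S3] using hp

theorem not_mem_unknot {p : ℂ × ℂ} (h : p.2 ≠ 0) : p ∉ unknot := by
  rintro ⟨z, rfl⟩
  exact h rfl

section RootInv

variable (n : ℤ) {q : ℂ × ℂ}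

theorem norm_rootInv_fst (hq : q.2 ≠ 0) : ‖(rootInv n q).1‖ = ‖q.1‖ := by
  simp [rootInv, norm_direction hq]

theorem norm_rootInv_snd (hq : q.2 ≠ 0) : ‖(rootInv n q).2‖ = ‖q.2‖ := by
  simp [rootInv, norm_direction hq]

theorem direction_rootInv_snd (hq : q.2 ≠ 0) :
    direction (rootInv n q).2 = direction q.2 ^ (-n) := by
  rw [rootInv, direction_mul, direction_ofReal (norm_pos_iff.2 hq), one_mul, direction_eq_self]
  rw [norm_zpow, norm_direction hq, one_zpow]

theorem rootInv_mem (hq : q ∈ S3) (hq2 : q.2 ≠ 0) : rootInv n q ∈ S3 \ unknot := by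
  constructor
  · change ‖_‖ ^ 2 + ‖_‖ ^ 2 = 1
    rw [norm_rootInv_fst n hq2, norm_rootInv_snd n hq2]
    exact hq
  · refine not_mem_unknot ?_
    rw [← norm_ne_zero_iff, norm_rootInv_snd n hq2]
    exact norm_ne_zero_iff.2 hq2

theorem rootInv_smul {c : ℂ} (hc : ‖c‖ = 1) (q : ℂ × ℂ) :
    rootInv n (c • q) = (q.1 * (direction q.2)⁻¹, ‖q.2‖ * (c ^ (-n) * direction q.2 ^ (-n))) := by
  have hc0 : c ≠ 0 := norm_ne_zero_iff.1 (by simp [hc])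
  simp only [rootInv, Prod.smul_fst, Prod.smul_snd, smul_eq_mul, direction_mul, norm_mul, hc,
    direction_eq_self hc, one_mul, mul_zpow]
  congr 1
  field_simp

theorem contDiffAt_rootInv (hq : q.2 ≠ 0) : ContDiffAt ℝ ∞ (rootInv n) q := by
  have direction_snd : ContDiffAt ℝ ∞ (fun p : ℂ × ℂ => direction p.2) q :=
    (contDiffAt_direction hq).comp q contDiffAt_snd
  have norm_snd : ContDiffAt ℝ ∞ (fun p : ℂ × ℂ => (‖p.2‖ : ℂ)) q :=
    (contDiffAt_ofReal_norm hq).comp q contDiffAt_snd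
  have direction_snd_zpow : ContDiffAt ℝ ∞ (fun p : ℂ × ℂ => direction p.2 ^ (-n)) q :=
    (contDiffAt_direction_zpow (-n) hq).comp q contDiffAt_snd
  exact (contDiffAt_fst.mul (direction_snd.inv (direction_ne_zero hq))).prodMk
    (norm_snd.mul direction_snd_zpow)

theorem rootLift_rootInv (hq : q.2 ≠ 0) : rootLift n (direction q.2) (rootInv n q) = q := by
  have hd := direction_ne_zero hq
  rw [rootLift, direction_rootInv_snd n hq, norm_rootInv_snd n hq,
    rootBranch_eq_self (by rw [zpow_neg, inv_inv]) (zpow_ne_zero _ hd)]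
  refine Prod.ext ?_ ?_
  · simp only [rootInv, Prod.smul_fst, smul_eq_mul]
    field_simp
  · simp only [Prod.smul_snd, smul_eq_mul]
    rw [mul_comm, norm_mul_direction]

end RootInv

section RootLift

variable {n : ℤ} (hn : n ≠ 0) {b : ℂ} (hb : b ≠ 0)

include hn in
theorem rootInv_root_smul {p : ℂ × ℂ} {c : ℂ} (hp : p.2 ≠ 0) (hc : c ^ n = (direction p.2)⁻¹) :
    rootInv n (c • (p.1, (‖p.2‖ : ℂ))) = p := by
  have norm_c : ‖c‖ = 1 :=
    norm_eq_one_of_norm_zpow hn (by rw [hc, norm_inv, norm_direction hp, inv_one])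
  simp only [rootInv_smul n norm_c, direction_ofReal (norm_pos_iff.2 hp), inv_one, mul_one,
    one_zpow, zpow_neg, hc, inv_inv, Complex.norm_real, norm_norm, norm_mul_direction]

theorem contDiffAt_rootLift {p : ℂ × ℂ} (hp : p.2 ≠ 0) (hbp : b ^ n = (direction p.2)⁻¹) :
    ContDiffAt ℝ ∞ (rootLift n b) p := by
  have norm_snd : ContDiffAt ℝ ∞ (fun p : ℂ × ℂ => (‖p.2‖ : ℂ)) p :=
    (contDiffAt_ofReal_norm hp).comp p contDiffAt_snd
  have root : ContDiffAt ℝ ∞ (fun p : ℂ × ℂ => rootBranch n b (direction p.2)) p :=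
    ContDiffAt.comp (g := rootBranch n b) p (contDiffAt_rootBranch hbp (direction_ne_zero hp))
      ((contDiffAt_direction hp).comp p contDiffAt_snd)
  exact root.smul (contDiffAt_fst.prodMk norm_snd)

include hn hb

theorem rootInv_rootLift {p : ℂ × ℂ} (hp : p.2 ≠ 0) : rootInv n (rootLift n b p) = p :=
  rootInv_root_smul hn hp (rootBranch_zpow hn hb _)

theorem rootLift_mem_S3 {p : ℂ × ℂ} (hp : p ∈ S3) (hp2 : p.2 ≠ 0) : rootLift n b p ∈ S3 :=
  smul_mem_S3 (norm_rootBranch hn hb (norm_direction hp2)) (norm_snd_mem_S3 hp)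

theorem norm_rootLift_fst {p : ℂ × ℂ} (hp : p.2 ≠ 0) : ‖(rootLift n b p).1‖ = ‖p.1‖ := by
  simp [rootLift, norm_rootBranch hn hb (norm_direction hp)]

theorem norm_rootLift_snd {p : ℂ × ℂ} (hp : p.2 ≠ 0) : ‖(rootLift n b p).2‖ = ‖p.2‖ := by
  simp [rootLift, norm_rootBranch hn hb (norm_direction hp)]

end RootLift

section IMap

variable {n : ℤ} (hn : n ≠ 0)

include hn

theorem mk_root_smul_eq_iMap {p : ↥(S3 \ unknot)} {c : ℂ} {q : S3}
    (hc : c ^ n = (direction p.1.2)⁻¹) (hq : q.1 = c • (p.1.1, (‖p.1.2‖ : ℂ))) :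
    Quotient.mk (lensSetoid n) q = iMap n p := by
  refine lens_mk_eq_of_zpow_eq hn hq (rootMap_eq_rootLift n p) ?_ ?_
  · rw [hc, rootBranch_zpow hn one_ne_zero]
  · rintro rfl
    rw [zero_zpow n hn] at hc
    exact inv_ne_zero (direction_ne_zero (snd_ne_zero p)) hc.symm

theorem mk_rootLift {b : ℂ} (hb : b ≠ 0) (p : ↥(S3 \ unknot)) :
    Quotient.mk (lensSetoid n) ⟨rootLift n b p.1, rootLift_mem_S3 hn hb p.2.1 (snd_ne_zero p)⟩ =
      iMap n p :=
  mk_root_smul_eq_iMap hn (rootBranch_zpow hn hb _) rfl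

theorem iMap_rootInv (q : S3) (hq : q.1.2 ≠ 0) :
    iMap n ⟨rootInv n q, rootInv_mem n q.2 hq⟩ = Quotient.mk (lensSetoid n) q := by
  rw [← mk_rootLift hn (direction_ne_zero hq)]
  exact congrArg _ (Subtype.ext (rootLift_rootInv n hq))

theorem rootInv_eq_of_mk_eq {q q' : S3}
    (h : Quotient.mk (lensSetoid n) q = Quotient.mk (lensSetoid n) q') :
    rootInv n q = rootInv n q' := by
  obtain ⟨c, hc, hq'⟩ := (lensSetoid_iff hn).1 (Quotient.exact h)
  have norm_c : ‖c‖ = 1 := norm_eq_one_of_norm_zpow hn (by rw [hc, norm_one])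
  rw [hq', rootInv_smul n norm_c, zpow_neg c, hc, inv_one, one_mul]
  rfl

theorem iMap_injective : Function.Injective (iMap n) := by
  intro p p' h
  have := rootInv_eq_of_mk_eq hn h
  rw [rootMap_eq_rootLift, rootMap_eq_rootLift,
    rootInv_rootLift hn one_ne_zero (snd_ne_zero p),
    rootInv_rootLift hn one_ne_zero (snd_ne_zero p')] at this
  exact Subtype.ext this

theorem continuous_iMap : Continuous (iMap n) := by
  rw [continuous_iff_continuousAt]
  intro p
  have hp := snd_ne_zero p
  obtain ⟨b, hb0, hb⟩ := exists_zpow_eq_inv hn _ (direction_ne_zero hp)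
  rw [show iMap n = _ from funext fun p => (mk_rootLift hn hb0 p).symm]
  refine (isFiniteScalarQuotient_lens hn).continuous.continuousAt.comp ?_
  exact Topology.IsInducing.subtypeVal.continuousAt_iff.2 (ContinuousAt.comp (f := Subtype.val)
    (contDiffAt_rootLift hp hb).continuousAt continuousAt_subtype_val)

theorem image_iMap (V : Set (ℂ × ℂ)) : iMap n '' (Subtype.val ⁻¹' V) =
    Quotient.mk (lensSetoid n) ''
      ({q : S3 | q.1.2 ≠ 0} ∩ (fun q : S3 => rootInv n q) ⁻¹' V) := by
  ext x
  constructor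
  · rintro ⟨p, hp, rfl⟩
    refine ⟨rootMap n p, ⟨?_, ?_⟩, rfl⟩
    · rw [Set.mem_ofPred_eq, rootMap_eq_rootLift, ← norm_ne_zero_iff,
        norm_rootLift_snd hn one_ne_zero (snd_ne_zero p), norm_ne_zero_iff]
      exact snd_ne_zero p
    · rw [Set.mem_preimage, rootMap_eq_rootLift,
        rootInv_rootLift hn one_ne_zero (snd_ne_zero p)]
      exact hp
  · rintro ⟨q, ⟨hq, hqV⟩, rfl⟩
    exact ⟨_, hqV, iMap_rootInv hn q hq⟩

theorem isOpenMap_iMap : IsOpenMap (iMap n) := by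
  intro U hU
  obtain ⟨V, hV, rfl⟩ := isOpen_induced_iff.1 hU
  rw [image_iMap hn]
  refine (isFiniteScalarQuotient_lens hn).isOpenMap _ (ContinuousOn.isOpen_inter_preimage
    (fun q hq => ?_) (isOpen_ne_fun (by fun_prop) continuous_const) hV)
  exact (ContinuousAt.comp (f := Subtype.val) (contDiffAt_rootInv n hq).continuousAt
    continuousAt_subtype_val).continuousWithinAt

end IMap

/-! ### The glued solid torus in the lens space -/

theorem fst_ne_zero_of_snd_eq_zero {q : ℂ × ℂ} (hq : q ∈ S3) (h : q.2 = 0) : q.1 ≠ 0 :=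
  fun h1 => ne_zero_of_mem_S3 hq (Prod.ext h1 h)

theorem direction_ofReal_mul {t : ℝ} (ht : 0 < t) (z : ℂ) : direction (t * z) = direction z := by
  rw [direction_mul, direction_ofReal ht, one_mul]

theorem radialProj_smul {c : ℂ} (hc : ‖c‖ = 1) (w : ℂ × ℂ) :
    radialProj (c • w) = c • radialProj w := by
  rw [radialProj, euclNorm_smul, hc, one_mul, smul_comm, radialProj]

/-- The point of the sphere on the ray through `(1, ε ā)`. The map which sends `(a, w)` to the class
of `w ^ (-1 / n)` times this point is the extension of `i_n` to the glued solid torus. -/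
def coreVec (ε : ℝ) (a : ℂ) : ℂ × ℂ := radialProj (1, ε * star a)

theorem one_prod_ne_zero (x : ℂ) : ((1 : ℂ), x) ≠ 0 := fun h => one_ne_zero (congrArg Prod.fst h)

theorem coreVec_mem_S3 (ε : ℝ) (a : ℂ) : coreVec ε a ∈ S3 := radialProj_mem_S3 (one_prod_ne_zero _)

theorem norm_snd_coreVec (ε : ℝ) (a : ℂ) : ‖(coreVec ε a).2‖ = |ε| * ‖a‖ * ‖(coreVec ε a).1‖ := by
  simp only [coreVec, radialProj, Prod.smul_fst, Prod.smul_snd, norm_smul, norm_mul, norm_star,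
    Complex.norm_real, Real.norm_eq_abs, norm_one]
  ring

theorem fst_coreVec_ne_zero (ε : ℝ) (a : ℂ) : (coreVec ε a).1 ≠ 0 :=
  smul_ne_zero (inv_ne_zero (euclNorm_pos (one_prod_ne_zero _)).ne') one_ne_zero

theorem contDiff_coreVec (ε : ℝ) : ContDiff ℝ ∞ (coreVec ε) := by
  have ray : ContDiff ℝ ∞ fun a : ℂ => ((1 : ℂ), (ε : ℂ) * star a) :=
    contDiff_const.prodMk (contDiff_const.mul (starL' ℝ : ℂ ≃L[ℝ] ℂ).contDiff)
  exact contDiff_iff_contDiffAt.2 fun a =>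
    ContDiffAt.comp a (contDiffAt_radialProj (one_prod_ne_zero _)) ray.contDiffAt

/-- A lift to the sphere of the map from the glued solid torus to the lens space, with the branch
`rootBranch n b` of the root. -/
def coreLift (ε : ℝ) (n : ℤ) (b : ℂ) (x : ℂ × ℂ) : ℂ × ℂ := rootBranch n b x.2 • coreVec ε x.1

/-- The coordinates in the glued solid torus of a point of the sphere: the inverse of the map from
the solid torus to the lens space. -/
def coreInv (ε : ℝ) (n : ℤ) (q : ℂ × ℂ) : ℂ × ℂ := (star (q.2 / q.1) / ε, direction q.1 ^ (-n))

section CoreInv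

variable (ε : ℝ) (n : ℤ)

theorem coreInv_real_smul {t : ℝ} (ht : 0 < t) (q : ℂ × ℂ) :
    coreInv ε n (t • q) = coreInv ε n q := by
  have ht' : (t : ℂ) ≠ 0 := Complex.ofReal_ne_zero.2 ht.ne'
  simp only [coreInv, Prod.smul_fst, Prod.smul_snd, direction_ofReal_mul ht, Complex.real_smul,
    mul_div_mul_left _ _ ht']

theorem coreInv_smul {c : ℂ} (hc : ‖c‖ = 1) (q : ℂ × ℂ) :
    coreInv ε n (c • q) = ((coreInv ε n q).1, c ^ (-n) * (coreInv ε n q).2) := by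
  have hc0 : c ≠ 0 := norm_ne_zero_iff.1 (by simp [hc])
  simp only [coreInv, Prod.smul_fst, Prod.smul_snd, smul_eq_mul, direction_mul,
    direction_eq_self hc, mul_div_mul_left _ _ hc0, mul_zpow]

theorem contDiffAt_coreInv {q : ℂ × ℂ} (hq : q.1 ≠ 0) : ContDiffAt ℝ ∞ (coreInv ε n) q := by
  have direction_fst_zpow : ContDiffAt ℝ ∞ (fun p : ℂ × ℂ => direction p.1 ^ (-n)) q :=
    (contDiffAt_direction_zpow (-n) hq).comp q contDiffAt_fst
  have slope : ContDiffAt ℝ ∞ (fun p : ℂ × ℂ => p.2 * p.1⁻¹) q :=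
    contDiffAt_snd.mul (contDiffAt_fst.inv hq)
  have star_slope : ContDiffAt ℝ ∞ (fun p : ℂ × ℂ => star (p.2 * p.1⁻¹) * (ε : ℂ)⁻¹) q :=
    ((starL' ℝ : ℂ ≃L[ℝ] ℂ).contDiff.contDiffAt.comp q slope).mul contDiffAt_const
  exact star_slope.prodMk direction_fst_zpow

variable {ε} (hε : ε ≠ 0)

include hε

theorem coreInv_coreVec (a : ℂ) : coreInv ε n (coreVec ε a) = (a, 1) := by
  have hε' : (ε : ℂ) ≠ 0 := Complex.ofReal_ne_zero.2 hε
  rw [coreVec, radialProj, coreInv_real_smul ε n (inv_pos.2 (euclNorm_pos (one_prod_ne_zero _)))]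
  simp [coreInv, direction, mul_div_cancel_left₀ _ hε']

theorem coreVec_coreInv_fst {q : ℂ × ℂ} (hq : q ∈ S3) (hq1 : q.1 ≠ 0) :
    coreVec ε (coreInv ε n q).1 = (direction q.1)⁻¹ • q := by
  have hε' : (ε : ℂ) ≠ 0 := Complex.ofReal_ne_zero.2 hε
  have norm_ne_zero : (‖q.1‖ : ℂ) ≠ 0 := by simpa using hq1
  have norm_inv_direction : ‖(direction q.1)⁻¹‖ = 1 := by rw [norm_inv, norm_direction hq1, inv_one]
  have ray : ((1 : ℂ), (ε : ℂ) * star (coreInv ε n q).1) =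
      ‖q.1‖⁻¹ • ((direction q.1)⁻¹ • q) := by
    refine Prod.ext ?_ ?_
    · simp only [direction, Prod.smul_fst, smul_eq_mul, Complex.real_smul]
      push_cast
      field_simp
    · simp only [coreInv, direction, Prod.smul_snd, smul_eq_mul, Complex.real_smul, star_div₀,
        star_star, show star (ε : ℂ) = ε from Complex.conj_ofReal ε]
      push_cast
      field_simp
  rw [coreVec, ray, radialProj_real_smul (inv_pos.2 (norm_pos_iff.2 hq1)),
    radialProj_of_mem_S3 (smul_mem_S3 norm_inv_direction hq)]

theorem coreLift_coreInv {q : ℂ × ℂ} (hq : q ∈ S3) (hq1 : q.1 ≠ 0) :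
    coreLift ε n (direction q.1) (coreInv ε n q) = q := by
  have hd := direction_ne_zero hq1
  rw [coreLift, coreVec_coreInv_fst n hε hq hq1, coreInv,
    rootBranch_eq_self (by rw [zpow_neg, inv_inv]) (zpow_ne_zero _ hd),
    smul_inv_smul₀ hd]

end CoreInv

theorem contDiffAt_coreLift (ε : ℝ) {n : ℤ} {b : ℂ} {x : ℂ × ℂ} (hb : b ^ n = x.2⁻¹)
    (hx : x.2 ≠ 0) : ContDiffAt ℝ ∞ (coreLift ε n b) x := by
  have root : ContDiffAt ℝ ∞ (fun x : ℂ × ℂ => rootBranch n b x.2) x :=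
    ContDiffAt.comp (g := rootBranch n b) x (contDiffAt_rootBranch hb hx) contDiffAt_snd
  exact root.smul ((contDiff_coreVec ε).contDiffAt.comp x contDiffAt_fst)

section CoreMap

variable {ε : ℝ} {n : ℤ} (hn : n ≠ 0)

include hn

section CoreLift

variable {b : ℂ} (hb : b ≠ 0) {x : ℂ × ℂ} (hx : ‖x.2‖ = 1)

include hb hx

theorem coreLift_mem_S3 : coreLift ε n b x ∈ S3 :=
  smul_mem_S3 (norm_rootBranch hn hb hx) (coreVec_mem_S3 ε _)

theorem fst_coreLift_ne_zero : (coreLift ε n b x).1 ≠ 0 := by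
  refine mul_ne_zero (norm_ne_zero_iff.1 ?_) (fst_coreVec_ne_zero ε _)
  rw [norm_rootBranch hn hb hx]
  exact one_ne_zero

theorem norm_snd_coreLift : ‖(coreLift ε n b x).2‖ = |ε| * ‖x.1‖ * ‖(coreLift ε n b x).1‖ := by
  simpa [coreLift, norm_rootBranch hn hb hx] using norm_snd_coreVec ε x.1

theorem coreInv_coreLift (hε : ε ≠ 0) : coreInv ε n (coreLift ε n b x) = x := by
  rw [coreLift, coreInv_smul ε n (norm_rootBranch hn hb hx), coreInv_coreVec n hε, zpow_neg,
    rootBranch_zpow hn hb, inv_inv, mul_one]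

end CoreLift

theorem coreInv_eq_of_mk_eq {q q' : S3}
    (h : Quotient.mk (lensSetoid n) q = Quotient.mk (lensSetoid n) q') :
    coreInv ε n q = coreInv ε n q' := by
  obtain ⟨c, hc, hq'⟩ := (lensSetoid_iff hn).1 (Quotient.exact h)
  have norm_c : ‖c‖ = 1 := norm_eq_one_of_norm_zpow hn (by rw [hc, norm_one])
  rw [hq', coreInv_smul ε n norm_c, zpow_neg, hc, inv_one, one_mul]

variable (ε) in
/-- The extension of `i_n` to the glued solid torus. -/
def coreMap (x : D2 × Circle) : Lens n :=
  Quotient.mk (lensSetoid n)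
    ⟨coreLift ε n 1 (x.1, x.2), coreLift_mem_S3 hn one_ne_zero (Circle.norm_coe x.2)⟩

theorem mk_root_smul_eq_coreMap {x : D2 × Circle} {c : ℂ} {q : S3} (hc : c ^ n = (x.2 : ℂ)⁻¹)
    (hq : q.1 = c • coreVec ε x.1) : Quotient.mk (lensSetoid n) q = coreMap ε hn x := by
  refine lens_mk_eq_of_zpow_eq hn (c' := rootBranch n 1 x.2) hq rfl ?_ ?_
  · rw [hc, rootBranch_zpow hn one_ne_zero]
  · rintro rfl
    rw [zero_zpow n hn] at hc
    exact inv_ne_zero (Circle.coe_ne_zero x.2) hc.symm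

theorem mk_coreLift {b : ℂ} (hb : b ≠ 0) (x : D2 × Circle) :
    Quotient.mk (lensSetoid n)
      ⟨coreLift ε n b (x.1, x.2), coreLift_mem_S3 hn hb (Circle.norm_coe x.2)⟩ = coreMap ε hn x :=
  mk_root_smul_eq_coreMap hn (rootBranch_zpow hn hb _) rfl

theorem coreMap_of_eq_coreInv (hε : ε ≠ 0) {q : S3} (hq1 : q.1.1 ≠ 0) {x : D2 × Circle}
    (hx : ((x.1 : ℂ), (x.2 : ℂ)) = coreInv ε n q) :
    coreMap ε hn x = Quotient.mk (lensSetoid n) q := by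
  rw [← mk_coreLift hn (direction_ne_zero hq1) x]
  refine congrArg _ (Subtype.ext ?_)
  change coreLift ε n _ ((x.1 : ℂ), (x.2 : ℂ)) = _
  rw [hx, coreLift_coreInv n hε q.2 hq1]

variable (ε) in
theorem continuous_coreMap : Continuous (coreMap ε hn) := by
  rw [continuous_iff_continuousAt]
  intro x
  obtain ⟨b, hb0, hb⟩ := exists_zpow_eq_inv hn _ (Circle.coe_ne_zero x.2)
  rw [show coreMap ε hn = _ from funext fun p => (mk_coreLift hn hb0 p).symm]
  refine (isFiniteScalarQuotient_lens hn).continuous.continuousAt.comp ?_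
  exact Topology.IsInducing.subtypeVal.continuousAt_iff.2 (ContinuousAt.comp
    (g := coreLift ε n b) (f := fun x : D2 × Circle => ((x.1 : ℂ), (x.2 : ℂ)))
    (contDiffAt_coreLift ε hb (Circle.coe_ne_zero x.2)).continuousAt (by fun_prop))

theorem coreMap_injective (hε : ε ≠ 0) : Function.Injective (coreMap ε hn) := by
  intro x x' h
  have coordinates := coreInv_eq_of_mk_eq (ε := ε) hn h
  rw [coreInv_coreLift hn one_ne_zero (Circle.norm_coe x.2) hε,
    coreInv_coreLift hn one_ne_zero (Circle.norm_coe x'.2) hε] at coordinates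
  exact Prod.ext (Subtype.ext (congrArg Prod.fst coordinates))
    (Circle.ext (congrArg Prod.snd coordinates))

end CoreMap

/-! ### The tube -/

/-- The vector `(z, ε w zⁿ)`, whose normalization is the point `j(z, w)` of the tube. -/
def tubeVec (ε : ℝ) (n : ℤ) (x : ℂ × ℂ) : ℂ × ℂ := (x.1, ε * x.2 * x.1 ^ n)

/-- The formula for the tube `j`, as a map that is smooth where the first coordinate is nonzero. -/
def tubeExt (ε : ℝ) (n : ℤ) (x : ℂ × ℂ) : ℂ × ℂ := radialProj (tubeVec ε n x)

/-- The coordinates `(z, w)` of the point `j(z, w)` of the tube. -/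
def tubeInv (ε : ℝ) (n : ℤ) (p : ℂ × ℂ) : ℂ × ℂ :=
  (direction p.1, p.2 / (ε * ‖p.1‖) * direction p.1 ^ (-n))

section Tube

variable (ε : ℝ) (n : ℤ)

theorem tubeVec_ne_zero {x : ℂ × ℂ} (hx : x.1 ≠ 0) : tubeVec ε n x ≠ 0 :=
  fun h => hx (congrArg Prod.fst h)

theorem tube_val (x : Circle × D2) : (tube ε n x).1 = tubeExt ε n (x.1, x.2) := by
  have norm_eq : euclNorm (tubeVec ε n (x.1, x.2)) = √(1 + ‖(ε : ℂ) * x.2‖ ^ 2) := by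
    simp [euclNorm, tubeVec, Circle.norm_coe]
  rw [tubeExt, radialProj, norm_eq, ← one_div]
  exact Complex.coe_smul _ _

theorem fst_tubeExt_ne_zero {x : ℂ × ℂ} (hx : x.1 ≠ 0) : (tubeExt ε n x).1 ≠ 0 :=
  smul_ne_zero (inv_ne_zero (euclNorm_pos (tubeVec_ne_zero ε n hx)).ne') hx

theorem contDiffAt_tubeExt {x : ℂ × ℂ} (hx : x.1 ≠ 0) : ContDiffAt ℝ ∞ (tubeExt ε n) x := by
  have zpow : ContDiffAt ℂ ∞ (fun z : ℂ => z ^ n) x.1 := (analyticAt_id.zpow hx).contDiffAt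
  have fst_zpow : ContDiffAt ℝ ∞ (fun x : ℂ × ℂ => x.1 ^ n) x :=
    (zpow.restrict_scalars ℝ).comp x contDiffAt_fst
  exact ContDiffAt.comp x (contDiffAt_radialProj (tubeVec_ne_zero ε n hx))
    (contDiffAt_fst.prodMk ((contDiffAt_const.mul contDiffAt_snd).mul fst_zpow))

theorem tubeInv_real_smul {t : ℝ} (ht : 0 < t) (p : ℂ × ℂ) :
    tubeInv ε n (t • p) = tubeInv ε n p := by
  have ht' : (t : ℂ) ≠ 0 := Complex.ofReal_ne_zero.2 ht.ne'
  simp only [tubeInv, Prod.smul_fst, Prod.smul_snd, Complex.real_smul, direction_ofReal_mul ht,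
    norm_mul, Complex.norm_real, Real.norm_of_nonneg ht.le, Complex.ofReal_mul,
    mul_left_comm _ (t : ℂ), mul_div_mul_left _ _ ht']

variable {ε} (hε : 0 < ε)

include hε

theorem contDiffAt_tubeInv {p : ℂ × ℂ} (hp : p.1 ≠ 0) : ContDiffAt ℝ ∞ (tubeInv ε n) p := by
  have direction_fst : ContDiffAt ℝ ∞ (fun p : ℂ × ℂ => direction p.1) p :=
    (contDiffAt_direction hp).comp p contDiffAt_fst
  have direction_fst_zpow : ContDiffAt ℝ ∞ (fun p : ℂ × ℂ => direction p.1 ^ (-n)) p :=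
    (contDiffAt_direction_zpow (-n) hp).comp p contDiffAt_fst
  have norm_fst : ContDiffAt ℝ ∞ (fun p : ℂ × ℂ => (ε : ℂ) * ‖p.1‖) p :=
    contDiffAt_const.mul ((contDiffAt_ofReal_norm hp).comp p contDiffAt_fst)
  have norm_fst_ne_zero : (ε : ℂ) * ‖p.1‖ ≠ 0 := by simpa [hε.ne'] using hp
  exact direction_fst.prodMk
    ((contDiffAt_snd.mul (norm_fst.inv norm_fst_ne_zero)).mul direction_fst_zpow)

theorem tubeInv_tubeExt {x : ℂ × ℂ} (hx : ‖x.1‖ = 1) : tubeInv ε n (tubeExt ε n x) = x := by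
  have hx0 : x.1 ≠ 0 := norm_ne_zero_iff.1 (by simp [hx])
  have hε' : (ε : ℂ) ≠ 0 := Complex.ofReal_ne_zero.2 hε.ne'
  have hxn := zpow_ne_zero n hx0
  rw [tubeExt, radialProj,
    tubeInv_real_smul ε n (inv_pos.2 (euclNorm_pos (tubeVec_ne_zero ε n hx0)))]
  refine Prod.ext (direction_eq_self hx) ?_
  simp only [tubeInv, tubeVec, direction_eq_self hx, hx, Complex.ofReal_one, mul_one, zpow_neg]
  field_simp

theorem tubeExt_tubeInv {p : ℂ × ℂ} (hp : p ∈ S3) (hp1 : p.1 ≠ 0) :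
    tubeExt ε n (tubeInv ε n p) = p := by
  have hε' : (ε : ℂ) ≠ 0 := Complex.ofReal_ne_zero.2 hε.ne'
  have hd := zpow_ne_zero n (direction_ne_zero hp1)
  have norm_fst_ne_zero : (‖p.1‖ : ℂ) ≠ 0 := by simpa using hp1
  have ray : tubeVec ε n (tubeInv ε n p) = ‖p.1‖⁻¹ • p := by
    refine Prod.ext ?_ ?_
    · simp only [tubeVec, tubeInv, direction, Prod.smul_fst, Complex.real_smul]
      push_cast
      field_simp
    · simp only [tubeVec, tubeInv, Prod.smul_snd, Complex.real_smul, zpow_neg]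
      push_cast
      field_simp
  rw [tubeExt, ray, radialProj_real_smul (inv_pos.2 (norm_pos_iff.2 hp1)), radialProj_of_mem_S3 hp]

theorem norm_tubeInv_snd {p : ℂ × ℂ} (hp1 : p.1 ≠ 0) :
    ‖(tubeInv ε n p).2‖ = ‖p.2‖ / (ε * ‖p.1‖) := by
  simp [tubeInv, norm_direction hp1, abs_of_pos hε]

theorem mem_range_tube {p : S3} (hp : p.1.1 ≠ 0) (h : ‖p.1.2‖ ≤ ε * ‖p.1.1‖) :
    p ∈ Set.range (tube ε n) := by
  refine ⟨(⟨(tubeInv ε n p).1, by simp [Submonoid.unitSphere, tubeInv, norm_direction hp]⟩,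
    ⟨(tubeInv ε n p).2, ?_⟩), Subtype.ext ?_⟩
  · rw [mem_closedBall_zero_iff, norm_tubeInv_snd n hε hp]
    exact div_le_one_of_le₀ h (by positivity)
  · exact (tube_val ε n _).trans (tubeExt_tubeInv n hε p.2 hp)

theorem mem_interior_range_tube {p : S3} (h : ‖p.1.2‖ < ε * ‖p.1.1‖) :
    p ∈ interior (Set.range (tube ε n)) := by
  have isOpen_solidTorus : IsOpen {p : S3 | ‖p.1.2‖ < ε * ‖p.1.1‖} :=
    isOpen_lt (by fun_prop) (by fun_prop)
  refine interior_maximal (fun q hq => mem_range_tube n hε ?_ (le_of_lt hq)) isOpen_solidTorus h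
  exact norm_pos_iff.1 (pos_of_mul_pos_right ((norm_nonneg _).trans_lt hq) hε.le)

theorem mem_interior_of_mem_unknot {p : S3} (hp : p.1 ∈ unknot) :
    p ∈ interior (Set.range (tube ε n)) := by
  obtain ⟨z, hz⟩ := hp
  refine mem_interior_range_tube n hε ?_
  rw [← hz, norm_zero, Circle.norm_coe, mul_one]
  exact hε

section Unit

variable {z w : ℂ} (hz : ‖z‖ = 1) (hw : ‖w‖ = 1) {r : ℝ} (hr : 0 < r)

include hz hw hr

theorem direction_snd_tubeExt : direction (tubeExt ε n (z, r * w)).2 = w * z ^ n := by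
  have hz0 : z ≠ 0 := norm_ne_zero_iff.1 (by simp [hz])
  have norm_zpow_z : ‖z ^ n‖ = 1 := by rw [norm_zpow, hz, one_zpow]
  rw [tubeExt, radialProj, Prod.smul_snd, Complex.real_smul,
    direction_ofReal_mul (inv_pos.2 (euclNorm_pos (tubeVec_ne_zero ε n hz0))), tubeVec]
  simp only [direction_mul, direction_ofReal hε, direction_ofReal hr, direction_eq_self hw,
    direction_eq_self norm_zpow_z, one_mul]

theorem coreVec_eq_inv_smul_tubeExt : coreVec ε (r * z) =
    z⁻¹ • ((tubeExt ε n (z, r * w)).1, (‖(tubeExt ε n (z, r * w)).2‖ : ℂ)) := by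
  have hz0 : z ≠ 0 := norm_ne_zero_iff.1 (by simp [hz])
  have norm_vec : euclNorm (tubeVec ε n (z, r * w)) = euclNorm (z, (ε * r : ℂ)) := by
    simp [euclNorm, tubeVec, hz, hw]
  have euclNorm_nonneg : 0 ≤ euclNorm (z, (ε * r : ℂ)) := Real.sqrt_nonneg _
  have norm_snd : ‖(tubeVec ε n (z, r * w)).2‖ = ε * r := by
    simp [tubeVec, hz, hw, abs_of_pos hε, abs_of_pos hr]
  have tubeExt_norm : ((tubeExt ε n (z, r * w)).1, (‖(tubeExt ε n (z, r * w)).2‖ : ℂ)) =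
      radialProj (z, ε * r) := by
    rw [tubeExt, radialProj, Prod.smul_snd, norm_smul, norm_snd, norm_vec, radialProj,
      Real.norm_of_nonneg (inv_nonneg.2 euclNorm_nonneg)]
    refine Prod.ext rfl ?_
    rw [Prod.smul_snd, Complex.real_smul]
    push_cast
    rfl
  have ray : ((1 : ℂ), (ε : ℂ) * star (r * z)) = z⁻¹ • (z, (ε * r : ℂ)) := by
    refine Prod.ext (inv_mul_cancel₀ hz0).symm ?_
    simp only [star_mul', show star (r : ℂ) = r from Complex.conj_ofReal r, Prod.smul_snd,
      smul_eq_mul, show star z = z⁻¹ from (Complex.inv_eq_conj hz).symm]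
    ring
  rw [tubeExt_norm, coreVec, ray, radialProj_smul (by rw [norm_inv, hz, inv_one])]

end Unit

theorem iMap_eq_coreMap {n : ℤ} (hn : n ≠ 0) {p : ↥(S3 \ unknot)} {x : D2 × Circle} {z : ℂ} {r : ℝ}
    (hr : 0 < r) (hz : ‖z‖ = 1) (hx : (x.1 : ℂ) = r * z)
    (hp : p.1 = tubeExt ε n (z, r * x.2)) : iMap n p = coreMap ε hn x := by
  have hw := Circle.norm_coe x.2
  rw [← mk_coreLift hn one_ne_zero x]
  symm
  refine mk_root_smul_eq_iMap hn (c := rootBranch n 1 x.2 * z⁻¹) ?_ ?_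
  · rw [mul_zpow, rootBranch_zpow hn one_ne_zero, hp, direction_snd_tubeExt n hε hz hw hr, inv_zpow,
      mul_inv]
  · change rootBranch n 1 x.2 • coreVec ε x.1 = _
    rw [hx, coreVec_eq_inv_smul_tubeExt n hε hz hw hr, hp, mul_smul]

end Tube

/-! ### The homeomorphism from the surgered manifold to the lens space -/

section Homeomorph

variable {ε : ℝ} (hε : 0 < ε) {n : ℤ}

/-- A point outside the interior of the tube, as a point of the complement of the unknot. -/
def outside (p : {p : S3 // p ∉ interior (Set.range (tube ε n))}) : ↥(S3 \ unknot) :=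
  ⟨p.1.1, p.1.2, fun h => p.2 (mem_interior_of_mem_unknot n hε h)⟩

include hε in
theorem tube_snd_ne_zero (z w : Circle) : (tube ε n (z, toDisk w)).1.2 ≠ 0 := by
  rw [tube_val]
  refine smul_ne_zero
    (inv_ne_zero (euclNorm_pos (tubeVec_ne_zero ε n (Circle.coe_ne_zero z))).ne') ?_
  exact mul_ne_zero (mul_ne_zero (Complex.ofReal_ne_zero.2 hε.ne') (Circle.coe_ne_zero w))
    (zpow_ne_zero n (Circle.coe_ne_zero z))

variable (hn : n ≠ 0)

include hε in
theorem iMap_eq_coreMap_of_boundary {p : ↥(S3 \ unknot)} {z w : Circle}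
    (hp : p.1 = (tube ε n (z, toDisk w)).1) : iMap n p = coreMap ε hn (toDisk z, w) := by
  refine iMap_eq_coreMap hε hn (z := z) one_pos (Circle.norm_coe z) ?_ ?_
  · rw [Complex.ofReal_one, one_mul]
    rfl
  · rw [Complex.ofReal_one, one_mul, hp, tube_val]
    rfl

/-- The extension of `i_n` to the surgered manifold. -/
def toLens : Surgery (tube ε n) → Lens n :=
  Quot.lift (Sum.elim (fun p => iMap n (outside hε p)) (coreMap ε hn)) (by
    rintro _ _ ⟨p, z, w, rfl, rfl, h⟩
    exact iMap_eq_coreMap_of_boundary hε hn (congrArg Subtype.val h))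

theorem continuous_toLens : Continuous (toLens hε hn) :=
  continuous_quot_lift _ (Continuous.sumElim
    ((continuous_iMap hn).comp (Continuous.subtype_mk (by fun_prop) _)) (continuous_coreMap ε hn))

theorem toLens_complementInclusion (p : ↥(S3 \ unknot)) :
    toLens hε hn (complementInclusion ε n p) = iMap n p := by
  unfold complementInclusion
  split_ifs with h
  · have fst_ne_zero := (norm_snd_le_of_mem_range (interior_subset h)).1
    have snd_ne_zero := snd_ne_zero p
    symm
    refine iMap_eq_coreMap hε hn (z := direction p.1.1)
      (r := ‖p.1.2‖ / (ε * ‖p.1.1‖)) (by positivity) (norm_direction fst_ne_zero) rfl ?_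
    have polar : tubeInv ε n p = (direction p.1.1, ((‖p.1.2‖ / (ε * ‖p.1.1‖) : ℝ) : ℂ) *
        (direction p.1.2 * direction p.1.1 ^ (-n))) := by
      rw [tubeInv, ← mul_assoc]
      nth_rewrite 1 [← norm_mul_direction p.1.2]
      push_cast
      congr 2
      ring
    refine (tubeExt_tubeInv n hε p.2.1 fst_ne_zero).symm.trans ?_
    rw [polar, Circle.coe_mul, Circle.coe_zpow]
    rfl
  · rfl

theorem toLens_surjective : Function.Surjective (toLens hε hn) := by
  intro x
  obtain ⟨q, rfl⟩ := Quotient.mk_surjective x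
  by_cases hq2 : q.1.2 = 0
  · have hq1 := fst_ne_zero_of_snd_eq_zero q.2 hq2
    refine ⟨Quot.mk _ (Sum.inr (center,
      ⟨direction q.1.1 ^ (-n), by simp [Submonoid.unitSphere, norm_direction hq1]⟩)), ?_⟩
    exact coreMap_of_eq_coreInv hn hε.ne' hq1 (by simp [coreInv, hq2, center])
  · exact ⟨complementInclusion ε n _, (toLens_complementInclusion hε hn _).trans
      (iMap_rootInv hn q hq2)⟩

include hn in
theorem norm_snd_of_iMap_eq_coreMap {p : ↥(S3 \ unknot)} {x : D2 × Circle}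
    (h : iMap n p = coreMap ε hn x) :
    p.1.1 ≠ 0 ∧ ‖p.1.2‖ = |ε| * ‖(x.1 : ℂ)‖ * ‖p.1.1‖ := by
  obtain ⟨c, hc, hx⟩ := (lensSetoid_iff hn).1 (Quotient.exact h)
  have norm_c : ‖c‖ = 1 := norm_eq_one_of_norm_zpow hn (by rw [hc, norm_one])
  change coreLift ε n 1 (x.1, x.2) = _ at hx
  have norm_fst : ‖(coreLift ε n 1 (x.1, x.2)).1‖ = ‖p.1.1‖ := by
    rw [hx, Prod.smul_fst, norm_smul, norm_c, one_mul, rootMap_eq_rootLift,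
      norm_rootLift_fst hn one_ne_zero (snd_ne_zero p)]
  have norm_snd : ‖(coreLift ε n 1 (x.1, x.2)).2‖ = ‖p.1.2‖ := by
    rw [hx, Prod.smul_snd, norm_smul, norm_c, one_mul, rootMap_eq_rootLift,
      norm_rootLift_snd hn one_ne_zero (snd_ne_zero p)]
  have hw := Circle.norm_coe x.2
  constructor
  · rw [← norm_ne_zero_iff, ← norm_fst, norm_ne_zero_iff]
    exact fst_coreLift_ne_zero hn one_ne_zero hw
  · rw [← norm_fst, ← norm_snd]
    exact norm_snd_coreLift hn one_ne_zero hw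

include hε in
theorem norm_eq_one_of_iMap_outside_eq_coreMap
    {p : {p : S3 // p ∉ interior (Set.range (tube ε n))}} {x : D2 × Circle}
    (h : iMap n (outside hε p) = coreMap ε hn x) : ‖(x.1 : ℂ)‖ = 1 := by
  obtain ⟨fst_ne_zero, norm_snd⟩ := norm_snd_of_iMap_eq_coreMap hn h
  change ‖p.1.1.2‖ = _ * ‖p.1.1.1‖ at norm_snd
  have le_norm_snd : ε * ‖p.1.1.1‖ ≤ ‖p.1.1.2‖ :=
    not_lt.1 fun h => p.2 (mem_interior_range_tube n hε h)
  rw [norm_snd, abs_of_pos hε, mul_assoc] at le_norm_snd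
  exact le_antisymm (mem_closedBall_zero_iff.1 x.1.2)
    ((le_mul_iff_one_le_left (norm_pos_iff.2 fst_ne_zero)).1 (le_of_mul_le_mul_left le_norm_snd hε))

theorem mk_inl_eq_mk_inr_of_iMap_eq (p : {p : S3 // p ∉ interior (Set.range (tube ε n))})
    (x : D2 × Circle) (h : iMap n (outside hε p) = coreMap ε hn x) :
    Quot.mk (gluing (tube ε n)) (Sum.inl p) = Quot.mk _ (Sum.inr x) := by
  obtain ⟨a, w⟩ := x
  have norm_a := norm_eq_one_of_iMap_outside_eq_coreMap hε hn h
  obtain ⟨z, rfl⟩ : ∃ z, a = toDisk z := ⟨⟨a, by simpa [Submonoid.unitSphere] using norm_a⟩, rfl⟩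
  have iMap_tube : iMap n ⟨(tube ε n (z, toDisk w)).1, (tube ε n (z, toDisk w)).2,
      not_mem_unknot (tube_snd_ne_zero hε z w)⟩ = coreMap ε hn (toDisk z, w) :=
    iMap_eq_coreMap_of_boundary hε hn rfl
  have eq_tube := congrArg Subtype.val (iMap_injective hn (h.trans iMap_tube.symm))
  exact Quot.sound ⟨p, z, w, rfl, rfl, Subtype.ext eq_tube⟩

theorem toLens_injective : Function.Injective (toLens hε hn) := by
  rintro ⟨p | x⟩ ⟨p' | x'⟩ h
  · have outside_eq : outside hε p = outside hε p' := iMap_injective hn h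
    have val_eq : p.1.1 = p'.1.1 := congrArg (fun q : ↥(S3 \ unknot) => q.1) outside_eq
    rw [Subtype.ext (Subtype.ext val_eq)]
  · exact mk_inl_eq_mk_inr_of_iMap_eq hε hn p x' h
  · exact (mk_inl_eq_mk_inr_of_iMap_eq hε hn p' x h.symm).symm
  · have point_eq : x = x' := coreMap_injective hn hε.ne' h
    rw [point_eq]

instance : CompactSpace D2 := isCompact_iff_compactSpace.1 (isCompact_closedBall 0 1)

instance (j : Circle × D2 → S3) : CompactSpace (Surgery j) := by
  have : CompactSpace {p : S3 // p ∉ interior (Set.range j)} :=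
    isCompact_iff_compactSpace.1 isOpen_interior.isClosed_compl.isCompact
  infer_instance

/-- The homeomorphism from the surgered manifold to the lens space that extends `i_n`. -/
def lensHomeomorph : Surgery (tube ε n) ≃ₜ Lens n :=
  haveI := (isFiniteScalarQuotient_lens hn).t2Space
  Continuous.homeoOfEquivCompactToT2
    (f := Equiv.ofBijective (toLens hε hn) ⟨toLens_injective hε hn, toLens_surjective hε hn⟩)
    (continuous_toLens hε hn)

theorem lensHomeomorph_complementInclusion (p : ↥(S3 \ unknot)) :
    lensHomeomorph hε hn (complementInclusion ε n p) = iMap n p :=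
  toLens_complementInclusion hε hn p

theorem complementInclusion_eq : complementInclusion ε n = (lensHomeomorph hε hn).symm ∘ iMap n :=
  funext fun p => ((lensHomeomorph hε hn).symm_apply_eq.2
    (lensHomeomorph_complementInclusion hε hn p).symm).symm

include hε hn

theorem isOpenEmbedding_complementInclusion :
    Topology.IsOpenEmbedding (complementInclusion ε n) := by
  rw [complementInclusion_eq hε hn]
  exact (lensHomeomorph hε hn).symm.isOpenEmbedding.comp
    (.of_continuous_injective_isOpenMap (continuous_iMap hn) (iMap_injective hn)
      (isOpenMap_iMap hn))

omit hε hn in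
theorem dense_snd_ne_zero : Dense {q : S3 | q.1.2 ≠ 0} := by
  intro q
  by_cases hq2 : q.1.2 = 0
  · have nudge_ne_zero (t : ℝ) : (q.1.1, (t : ℂ)) ≠ 0 :=
      fun h => fst_ne_zero_of_snd_eq_zero q.2 hq2 (congrArg Prod.fst h)
    let nudge (t : ℝ) : S3 := ⟨radialProj (q.1.1, t), radialProj_mem_S3 (nudge_ne_zero t)⟩
    have continuous_nudge : Continuous nudge := Continuous.subtype_mk
      (continuous_iff_continuousAt.2 fun t => ContinuousAt.comp (g := radialProj)
        (contDiffAt_radialProj (nudge_ne_zero t)).continuousAt (by fun_prop)) _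
    have nudge_zero : nudge 0 = q := by
      refine Subtype.ext ((congrArg radialProj ?_).trans (radialProj_of_mem_S3 q.2))
      rw [Complex.ofReal_zero, ← hq2]
    have tendsto_nudge : Filter.Tendsto nudge (𝓝[>] 0) (𝓝 q) :=
      ((continuous_nudge.tendsto 0).mono_left nhdsWithin_le_nhds).trans_eq (by rw [nudge_zero])
    refine mem_closure_of_tendsto tendsto_nudge ?_
    filter_upwards [self_mem_nhdsWithin] with t ht
    exact smul_ne_zero (inv_ne_zero (euclNorm_pos (nudge_ne_zero t)).ne')
      (Complex.ofReal_ne_zero.2 (ne_of_gt ht))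
  · exact subset_closure hq2

theorem denseRange_complementInclusion : DenseRange (complementInclusion ε n) := by
  rw [complementInclusion_eq hε hn]
  refine (lensHomeomorph hε hn).symm.surjective.denseRange.comp ?_
    (lensHomeomorph hε hn).symm.continuous
  have quotient := isFiniteScalarQuotient_lens hn
  refine (quotient.surjective.denseRange.dense_image quotient.continuous dense_snd_ne_zero).mono ?_
  rintro _ ⟨q, hq, rfl⟩
  exact ⟨_, iMap_rootInv hn q hq⟩

theorem complementInclusion_tube {z w : Circle} {t : D2} {p : ↥(S3 \ unknot)} {a : D2} {r : ℝ}
    (hr : 0 < r) (ht : (t : ℂ) = r * w) (ha : (a : ℂ) = r * z)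
    (hp : (p : ℂ × ℂ) = tube ε n (z, t)) :
    complementInclusion ε n p = Quot.mk _ (Sum.inr (a, w)) := by
  apply toLens_injective hε hn
  rw [toLens_complementInclusion]
  exact iMap_eq_coreMap hε hn hr (Circle.norm_coe z) ha (by rw [hp, tube_val, ht])

theorem existsUnique_homeomorph :
    ∃! Φ : Surgery (tube ε n) ≃ₜ Lens n, ∀ p, Φ (complementInclusion ε n p) = iMap n p := by
  have := (isFiniteScalarQuotient_lens hn).t2Space
  refine ⟨lensHomeomorph hε hn, lensHomeomorph_complementInclusion hε hn, fun Ψ hΨ => ?_⟩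
  refine Homeomorph.ext fun x => congrFun ((denseRange_complementInclusion hε hn).equalizer
    Ψ.continuous (lensHomeomorph hε hn).continuous (funext fun p => ?_)) x
  exact (hΨ p).trans (lensHomeomorph_complementInclusion hε hn p).symm

end Homeomorph

/-! ### The Jacobian determinant of the inverse of `i_n` -/

theorem hasDerivAt_add_smul {E : Type*} [NormedAddCommGroup E] [NormedSpace ℝ E] (x v : E) :
    HasDerivAt (fun t : ℝ => x + t • v) v 0 := by
  simpa using ((hasDerivAt_id (0 : ℝ)).smul_const v).const_add x

theorem hasLineDerivAt_norm {z : ℂ} (hz : z ≠ 0) (w : ℂ) :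
    HasLineDerivAt ℝ (fun z : ℂ => ‖z‖) (star (direction z) * w).re z w := by
  have deriv_sqrt := (hasDerivAt_add_smul z w).norm_sq.sqrt (by simpa using hz)
  simp only [zero_smul, add_zero, Real.sqrt_sq (norm_nonneg _)] at deriv_sqrt
  refine deriv_sqrt.congr_deriv ?_
  rw [Complex.inner, mul_div_mul_left _ _ two_ne_zero, direction]
  simp only [Complex.star_def, map_div₀, Complex.conj_ofReal, div_mul_eq_mul_div,
    Complex.div_ofReal_re]
  rw [mul_comm]

theorem star_direction_mul_direction {z : ℂ} (hz : z ≠ 0) :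
    star (direction z) * direction z = 1 := by
  rw [Complex.star_def, Complex.conj_mul', norm_direction hz, Complex.ofReal_one, one_pow]

theorem star_direction_mul_self {z : ℂ} (hz : z ≠ 0) : star (direction z) * z = (‖z‖ : ℂ) := by
  conv_lhs => rw [← norm_mul_direction z, direction_ofReal_mul (norm_pos_iff.2 hz)]
  rw [mul_left_comm, direction_eq_self (norm_direction hz), star_direction_mul_direction hz,
    mul_one]

/-- Only the component of `w` orthogonal to `z` turns the direction of `z`. -/
theorem hasLineDerivAt_direction {z : ℂ} (hz : z ≠ 0) (w : ℂ) :
    HasLineDerivAt ℝ direction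
      (direction z * (Complex.I * ((star (direction z) * w).im / ‖z‖))) z w := by
  have norm_ne_zero : (‖z‖ : ℂ) ≠ 0 := by simpa using hz
  have deriv_div := (hasDerivAt_add_smul z w).div (hasLineDerivAt_norm hz w).ofReal_comp
    (by simpa using hz)
  simp only [zero_smul, add_zero] at deriv_div
  refine deriv_div.congr_deriv ?_
  have polar : w = direction z *
      ((star (direction z) * w).re + (star (direction z) * w).im * Complex.I) := by
    rw [Complex.re_add_im, ← mul_assoc, mul_comm (direction z), star_direction_mul_direction hz,
      one_mul]
  have hz_polar := norm_mul_direction z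
  generalize (star (direction z) * w).re = ρ at *
  generalize (star (direction z) * w).im = μ at *
  rw [polar]
  field_simp
  linear_combination (ρ : ℂ) * hz_polar

theorem hasLineDerivAt_direction_zpow (m : ℤ) {z : ℂ} (hz : z ≠ 0) (w : ℂ) :
    HasLineDerivAt ℝ (fun z => direction z ^ m)
      (direction z ^ m * (m * Complex.I * ((star (direction z) * w).im / ‖z‖))) z w := by
  have direction_ne := direction_ne_zero hz
  have deriv_zpow : HasDerivAt (fun d : ℂ => d ^ m) _ (direction (z + (0 : ℝ) • w)) :=
    hasDerivAt_zpow m _ (Or.inl (by simpa using direction_ne))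
  refine (deriv_zpow.comp_of_eq (0 : ℝ) (hasLineDerivAt_direction hz w) rfl).congr_deriv ?_
  rw [zero_smul, add_zero, zpow_sub_one₀ direction_ne]
  field_simp

theorem fderiv_rootInv (n : ℤ) {q : ℂ × ℂ} (hq : q.2 ≠ 0) (v : ℂ × ℂ) :
    fderiv ℝ (rootInv n) q v =
      ((direction q.2)⁻¹ *
          (v.1 - Complex.I * q.1 / ‖q.2‖ * ((star (direction q.2) * v.2).im : ℂ)),
        direction q.2 ^ (-n) *
          ⟨(star (direction q.2) * v.2).re, -n * (star (direction q.2) * v.2).im⟩) := by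
  have norm_ne_zero : (‖q.2‖ : ℂ) ≠ 0 := by simpa using hq
  have line_fst : HasDerivAt (fun t : ℝ => (q + t • v).1) v.1 0 := hasDerivAt_add_smul q.1 v.1
  have rootInv_eq : rootInv n =
      fun q => (q.1 * direction q.2 ^ (-1 : ℤ), ‖q.2‖ * direction q.2 ^ (-n)) := by
    simp only [zpow_neg_one]
    rfl
  have line_rootInv := (line_fst.mul (hasLineDerivAt_direction_zpow (-1) hq v.2)).prodMk
    ((hasLineDerivAt_norm hq v.2).ofReal_comp.mul (hasLineDerivAt_direction_zpow (-n) hq v.2))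
  rw [← ((contDiffAt_rootInv n hq).differentiableAt (by simp)).lineDeriv_eq_fderiv, rootInv_eq]
  refine line_rootInv.deriv.trans ?_
  simp only [zero_smul, add_zero, zpow_neg_one]
  generalize direction q.2 = c
  refine Prod.ext ?_ ?_
  · push_cast
    field_simp
    ring
  · generalize star c * v.2 = b
    rw [← Complex.re_add_im ⟨_, _⟩]
    push_cast
    field_simp

theorem fderiv_rootInv_self (n : ℤ) {q : ℂ × ℂ} (hq : q.2 ≠ 0) :
    fderiv ℝ (rootInv n) q q = rootInv n q := by
  rw [fderiv_rootInv n hq, star_direction_mul_self hq, rootInv, Complex.ofReal_re,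
    Complex.ofReal_im, Complex.ofReal_zero, mul_zero, mul_zero, sub_zero, mul_comm q.1,
    mul_comm (‖q.2‖ : ℂ)]
  rfl

/-- The derivative of the inverse of `i_n` is a shear between two pairs of rotations. -/
theorem frameDet_fderiv_rootInv (n : ℤ) {q : ℂ × ℂ} (hq : q.2 ≠ 0) (p : ℂ × ℂ)
    (T : E3 → ℂ × ℂ) :
    frameDet (fderiv ℝ (rootInv n) q p) (fun x => fderiv ℝ (rootInv n) q (T x)) =
      -n * frameDet p T := by
  simp only [fderiv_rootInv n hq]
  have norm_c := norm_direction hq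
  generalize direction q.2 = c at *
  have rotate_source := frameDet_prodMap_mul 1 (star c) p T
  have rotate_target := frameDet_prodMap_mul c⁻¹ (c ^ (-n))
    (p.1 - Complex.I * q.1 / ‖q.2‖ * ((star c * p.2).im : ℂ),
      ⟨(star c * p.2).re, -n * (star c * p.2).im⟩)
    (fun x => ((T x).1 - Complex.I * q.1 / ‖q.2‖ * ((star c * (T x).2).im : ℂ),
      ⟨(star c * (T x).2).re, -n * (star c * (T x).2).im⟩))
  have shear := frameDet_shear (Complex.I * q.1 / ‖q.2‖) (-n) (p.1, star c * p.2)
    (fun x => ((T x).1, star c * (T x).2))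
  simp only [one_mul, norm_one, one_pow, norm_star, norm_inv, inv_one, norm_zpow, one_zpow,
    norm_c] at rotate_source rotate_target
  rw [rotate_target, shear, rotate_source]

theorem paramDet_rootInv_comp (n : ℤ) {φ : E3 → ℂ × ℂ} {y : E3} (hφ : DifferentiableAt ℝ φ y)
    (hy : (φ y).2 ≠ 0) : paramDet (rootInv n ∘ φ) y = -n * paramDet φ y := by
  rw [paramDet, fderiv_comp y ((contDiffAt_rootInv n hy).differentiableAt (by simp)) hφ,
    Function.comp_apply, ← fderiv_rootInv_self n hy]
  exact frameDet_fderiv_rootInv n hy (φ y) (fderiv ℝ φ y)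

/-! ### The atlas of the surgered manifold -/

theorem IsSmoothLiftAt.comp {M X X' : Type*} [TopologicalSpace M] {ι : X → ℂ × ℂ} {π : X → M}
    {ι' : X' → ℂ × ℂ} {π' : X' → M} {e : OpenPartialHomeomorph M E3} {x : X} {x' : X'}
    {φ : E3 → ℂ × ℂ} {g : ℂ × ℂ → ℂ × ℂ} (h : IsSmoothLiftAt ι π e x φ)
    (hg : ContDiffAt ℝ ∞ g (ι x)) (base : π' x' = π x) (value : g (ι x) = ι' x')
    (lift : ∀ᶠ x₁ in (𝓝 (ι x)).comap ι, ∃ x₂, ι' x₂ = g (ι x₁) ∧ π' x₂ = π x₁) :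
    IsSmoothLiftAt ι' π' e x' (g ∘ φ) := by
  obtain ⟨smooth, φ_at, φ_lifts⟩ := h
  have tendsto_φ := smooth.continuousAt.tendsto
  rw [φ_at] at tendsto_φ
  rw [IsSmoothLiftAt, base]
  refine ⟨ContDiffAt.comp _ (by rwa [φ_at]) smooth, by rw [Function.comp_apply, φ_at, value], ?_⟩
  filter_upwards [φ_lifts, tendsto_φ.eventually (Filter.eventually_comap.1 lift)]
    with y ⟨x₁, hx₁, hy₁⟩ hy
  obtain ⟨x₂, hx₂, hy₂⟩ := hy x₁ hx₁
  exact ⟨x₂, by rw [hx₂, hx₁, Function.comp_apply], hy₂.trans hy₁⟩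

theorem IsFiniteScalarQuotient.eventuallyEq_of_isSmoothLiftAt {M : Type*} [TopologicalSpace M]
    {G : Set ℂ} {π : S3 → M} {e : OpenPartialHomeomorph M E3} {q : S3} {φ ψ : E3 → ℂ × ℂ}
    (h : IsFiniteScalarQuotient G π) (hφ : IsSmoothLiftAt Subtype.val π e q φ)
    (hψ : IsSmoothLiftAt Subtype.val π e q ψ) : φ =ᶠ[𝓝 (e (π q))] ψ :=
  h.lift_eventuallyEq hφ.1.continuousAt hψ.1.continuousAt (hφ.2.1.trans hψ.2.1.symm) hφ.2.2 hψ.2.2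

theorem paramDet_congr {φ ψ : E3 → ℂ × ℂ} {y : E3} (h : φ =ᶠ[𝓝 y] ψ) :
    paramDet φ y = paramDet ψ y := by
  rw [paramDet, paramDet, h.fderiv_eq, h.self_of_nhds]

theorem paramDet_ne_zero_of_injective_fderiv_comp {F : Type*} [NormedAddCommGroup F]
    [NormedSpace ℝ F] {f : ℂ × ℂ → F} {ψ : E3 → ℂ × ℂ} {y : E3}
    (hf : DifferentiableAt ℝ f (ψ y)) (hψ : DifferentiableAt ℝ ψ y)
    (radial : fderiv ℝ f (ψ y) (ψ y) = 0) (hy : ψ y ≠ 0)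
    (injective : Function.Injective (fderiv ℝ (f ∘ ψ) y)) : paramDet ψ y ≠ 0 := by
  rw [fderiv_comp y hf hψ] at injective
  rw [paramDet, frameDet_ne_zero_iff]
  intro l v hlv
  have image_v : fderiv ℝ f (ψ y) (fderiv ℝ ψ y v) = 0 := by
    simpa [radial] using congrArg (fderiv ℝ f (ψ y)) hlv
  have hv : v = 0 := injective (by rw [ContinuousLinearMap.comp_apply, image_v, map_zero])
  rw [hv, map_zero, add_zero] at hlv
  exact ⟨(smul_eq_zero.1 hlv).resolve_right hy, hv⟩

theorem frequently_snd_ne_zero {ψ : E3 → ℂ × ℂ} {y : E3} (hψ : DifferentiableAt ℝ ψ y)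
    (h : paramDet ψ y ≠ 0) : ∃ᶠ z in 𝓝 y, (ψ z).2 ≠ 0 := by
  intro eventually_zero
  have snd_eq : (fun z => (ψ z).2) =ᶠ[𝓝 y] fun _ => 0 :=
    eventually_zero.mono fun z hz => not_not.1 hz
  have deriv_snd (v : E3) : (fderiv ℝ ψ y v).2 = 0 :=
    DFunLike.congr_fun (hψ.hasFDerivAt.snd.fderiv.symm.trans
      (snd_eq.fderiv_eq.trans (fderiv_const_apply 0))) v
  exact h (by simp [paramDet, frameDet, orientationDet_apply, deriv_snd, snd_eq.self_of_nhds])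

theorem fderiv_coreInv_self (ε : ℝ) (n : ℤ) {q : ℂ × ℂ} (hq : q.1 ≠ 0) :
    fderiv ℝ (coreInv ε n) q q = 0 := by
  have constant_on_ray : (fun t : ℝ => coreInv ε n (q + t • q)) =ᶠ[𝓝 0] fun _ => coreInv ε n q := by
    filter_upwards [lt_mem_nhds (show (-1 : ℝ) < 0 by norm_num)] with t ht
    rw [← coreInv_real_smul ε n (show 0 < 1 + t by linarith) q, add_smul, one_smul]
  rw [← ((contDiffAt_coreInv ε n hq).differentiableAt (by simp)).lineDeriv_eq_fderiv]
  exact constant_on_ray.deriv_eq.trans (deriv_const 0 _)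

/-- The coordinates in `ℂ²` of the glued solid torus. -/
abbrev torusCoords (x : D2 × Circle) : ℂ × ℂ := (x.1, x.2)

/-- The map from the glued solid torus to the surgered manifold. -/
abbrev torusInclusion (ε : ℝ) (n : ℤ) (x : D2 × Circle) : Surgery (tube ε n) :=
  Quot.mk _ (Sum.inr x)

section SurgeryAtlas

variable {ε : ℝ} (hε : 0 < ε) {n : ℤ} (hn : n ≠ 0)

/-- The quotient map from the sphere to the surgered manifold, by way of the lens space. -/
def toSurgery (q : S3) : Surgery (tube ε n) :=
  (lensHomeomorph hε hn).symm (Quotient.mk (lensSetoid n) q)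

theorem isFiniteScalarQuotient_toSurgery :
    IsFiniteScalarQuotient {c : ℂ | c ^ n = 1} (toSurgery hε hn) where
  finite := finite_setOf_zpow_eq_one hn
  continuous := (lensHomeomorph hε hn).symm.continuous.comp
    (isFiniteScalarQuotient_lens hn).continuous
  isOpenMap := (lensHomeomorph hε hn).symm.isOpenMap.comp (isFiniteScalarQuotient_lens hn).isOpenMap
  surjective := (lensHomeomorph hε hn).symm.surjective.comp
    (isFiniteScalarQuotient_lens hn).surjective
  eq_iff p q := (lensHomeomorph hε hn).symm.injective.eq_iff.trans
    ((isFiniteScalarQuotient_lens hn).eq_iff p q)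

theorem toSurgery_eq_complementInclusion {q : S3} {p : ↥(S3 \ unknot)} (hp : p.1 = rootInv n q) :
    toSurgery hε hn q = complementInclusion ε n p := by
  obtain ⟨p, hpS⟩ := p
  subst hp
  have hq : q.1.2 ≠ 0 := fun h => snd_ne_zero ⟨_, hpS⟩ (by simp [rootInv, h])
  rw [toSurgery, complementInclusion_eq hε hn, ← iMap_rootInv hn q hq]
  rfl

theorem toSurgery_eq_torusInclusion {q : S3} {x : D2 × Circle} (hq : q.1.1 ≠ 0)
    (hx : torusCoords x = coreInv ε n q) : toSurgery hε hn q = torusInclusion ε n x := by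
  rw [toSurgery, ← coreMap_of_eq_coreInv hn hε.ne' hq hx]
  exact (lensHomeomorph hε hn).symm_apply_apply (torusInclusion ε n x)

section Lifts

variable {e : OpenPartialHomeomorph (Surgery (tube ε n)) E3} {q : S3} {p : ↥(S3 \ unknot)}
  {x : D2 × Circle} {φ : E3 → ℂ × ℂ} {b : ℂ}

theorem isSmoothLiftAt_rootInv_comp (h : IsSmoothLiftAt Subtype.val (toSurgery hε hn) e q φ)
    (hp : p.1 = rootInv n q) (hq : q.1.2 ≠ 0) :
    IsSmoothLiftAt Subtype.val (complementInclusion ε n) e p (rootInv n ∘ φ) := by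
  refine h.comp (contDiffAt_rootInv n hq) (toSurgery_eq_complementInclusion hε hn hp).symm hp.symm
    ?_
  filter_upwards [Filter.tendsto_comap.eventually (continuousAt_snd.eventually_ne hq)] with q' hq'
  exact ⟨⟨_, rootInv_mem n q'.2 hq'⟩, rfl, (toSurgery_eq_complementInclusion hε hn rfl).symm⟩

theorem isSmoothLiftAt_rootLift_comp
    (h : IsSmoothLiftAt Subtype.val (complementInclusion ε n) e p φ) (hb : b ≠ 0)
    (hbp : b ^ n = (direction p.1.2)⁻¹) (hq : q.1 = rootLift n b p) :
    IsSmoothLiftAt Subtype.val (toSurgery hε hn) e q (rootLift n b ∘ φ) := by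
  have rootInv_lift (p : ↥(S3 \ unknot)) : p.1 = rootInv n (rootLift n b p) :=
    (rootInv_rootLift hn hb (snd_ne_zero p)).symm
  refine h.comp (contDiffAt_rootLift (snd_ne_zero p) hbp)
    (toSurgery_eq_complementInclusion hε hn (by rw [hq, ← rootInv_lift])) hq.symm
    (.of_forall fun p' => ?_)
  exact ⟨⟨_, rootLift_mem_S3 hn hb p'.2.1 (snd_ne_zero p')⟩, rfl,
    toSurgery_eq_complementInclusion hε hn (rootInv_lift p')⟩

theorem isSmoothLiftAt_coreInv_comp (h : IsSmoothLiftAt Subtype.val (toSurgery hε hn) e q φ)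
    (hq : q.1.1 ≠ 0) (hx : torusCoords x = coreInv ε n q) (hx1 : ‖(x.1 : ℂ)‖ < 1) :
    IsSmoothLiftAt torusCoords (torusInclusion ε n) e x (coreInv ε n ∘ φ) := by
  have smooth := contDiffAt_coreInv ε n hq
  refine h.comp smooth (toSurgery_eq_torusInclusion hε hn hq hx).symm hx.symm ?_
  have eventually_interior : ∀ᶠ p in 𝓝 q.1, ‖(coreInv ε n p).1‖ < 1 :=
    smooth.continuousAt.fst.norm.eventually_lt continuousAt_const (by rwa [← hx])
  filter_upwards [Filter.tendsto_comap.eventually eventually_interior,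
    Filter.tendsto_comap.eventually (continuousAt_fst.eventually_ne hq)] with q' interior hq'
  let x' : D2 × Circle := (⟨_, mem_closedBall_zero_iff.2 interior.le⟩,
    ⟨direction q'.1.1 ^ (-n), by simp [Submonoid.unitSphere, norm_direction hq']⟩)
  exact ⟨x', rfl, (toSurgery_eq_torusInclusion hε hn hq' rfl).symm⟩

theorem isSmoothLiftAt_coreLift_comp
    (h : IsSmoothLiftAt torusCoords (torusInclusion ε n) e x φ) (hb : b ≠ 0)
    (hbx : b ^ n = (x.2 : ℂ)⁻¹) (hq : q.1 = coreLift ε n b (torusCoords x)) :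
    IsSmoothLiftAt Subtype.val (toSurgery hε hn) e q (coreLift ε n b ∘ φ) := by
  have lift_spec (q : S3) (x : D2 × Circle) (hq : q.1 = coreLift ε n b (torusCoords x)) :
      toSurgery hε hn q = torusInclusion ε n x := by
    have norm_x := Circle.norm_coe x.2
    refine toSurgery_eq_torusInclusion hε hn ?_ ?_ <;> rw [hq]
    · exact fst_coreLift_ne_zero hn hb norm_x
    · exact (coreInv_coreLift hn hb norm_x hε.ne').symm
  refine h.comp (contDiffAt_coreLift ε hbx (Circle.coe_ne_zero x.2)) (lift_spec q x hq) hq.symm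
    (.of_forall fun x' => ?_)
  exact ⟨⟨_, coreLift_mem_S3 hn hb (Circle.norm_coe x'.2)⟩, rfl, lift_spec _ x' rfl⟩

end Lifts

section OrientedToSurgery

variable {e : OpenPartialHomeomorph (Surgery (tube ε n)) E3}
  (he : e ∈ orientedAtlas (toSurgery hε hn) (-n))

include he

theorem exists_isPositiveAt_lift_of_mem_orientedAtlas {p : ↥(S3 \ unknot)}
    (hp : complementInclusion ε n p ∈ e.source) :
    ∃ φ, IsSmoothLiftAt Subtype.val (complementInclusion ε n) e p φ ∧
      IsPositiveAt φ (e (complementInclusion ε n p)) := by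
  have hp2 := snd_ne_zero p
  let q : S3 := ⟨rootLift n 1 p, rootLift_mem_S3 hn one_ne_zero p.2.1 hp2⟩
  have hpq : p.1 = rootInv n q := (rootInv_rootLift hn one_ne_zero hp2).symm
  have hq2 : q.1.2 ≠ 0 := by
    rwa [← norm_ne_zero_iff, norm_rootLift_snd hn one_ne_zero hp2, norm_ne_zero_iff]
  have base := toSurgery_eq_complementInclusion hε hn hpq
  obtain ⟨φ, hφ, φ_sign⟩ := he q (by rwa [base])
  refine ⟨rootInv n ∘ φ, isSmoothLiftAt_rootInv_comp hε hn hφ hpq hq2, ?_⟩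
  rwa [isPositiveAt_iff_paramDet_pos, ← base,
    paramDet_rootInv_comp n (hφ.1.differentiableAt (by simp)) (by rwa [hφ.2.1])]

theorem exists_immersive_lift_of_mem_orientedAtlas {x : D2 × Circle} (hx : ‖(x.1 : ℂ)‖ < 1)
    (hxe : torusInclusion ε n x ∈ e.source) :
    ∃ φ, IsSmoothLiftAt torusCoords (torusInclusion ε n) e x φ ∧
      Function.Injective (fderiv ℝ φ (e (torusInclusion ε n x))) := by
  have norm_x := Circle.norm_coe x.2
  obtain ⟨b, hb, hbx⟩ := exists_zpow_eq_inv hn x.2 (Circle.coe_ne_zero x.2)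
  let q : S3 := ⟨coreLift ε n b (torusCoords x), coreLift_mem_S3 hn hb norm_x⟩
  have hq1 : q.1.1 ≠ 0 := fst_coreLift_ne_zero hn hb norm_x
  have hxq : torusCoords x = coreInv ε n q := (coreInv_coreLift hn hb norm_x hε.ne').symm
  have base := toSurgery_eq_torusInclusion hε hn hq1 hxq
  obtain ⟨φ, hφ, φ_sign⟩ := he q (by rwa [base])
  have hψ := isSmoothLiftAt_coreInv_comp hε hn hφ hq1 hxq hx
  refine ⟨coreInv ε n ∘ φ, hψ, ?_⟩
  have relift : φ =ᶠ[𝓝 (e (toSurgery hε hn q))] coreLift ε n b ∘ coreInv ε n ∘ φ :=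
    (isFiniteScalarQuotient_toSurgery hε hn).eventuallyEq_of_isSmoothLiftAt hφ
      (isSmoothLiftAt_coreLift_comp hε hn hψ hb hbx rfl)
  have φ_immersion := injective_fderiv_of_paramDet_ne_zero (right_ne_zero_of_mul φ_sign.ne')
  have smooth_coreLift : ContDiffAt ℝ ∞ (coreLift ε n b)
      ((coreInv ε n ∘ φ) (e (torusInclusion ε n x))) := by
    rw [hψ.2.1]
    exact contDiffAt_coreLift ε hbx (Circle.coe_ne_zero x.2)
  rw [relift.fderiv_eq, base, fderiv_comp _ (smooth_coreLift.differentiableAt (by simp))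
    (hψ.1.differentiableAt (by simp))] at φ_immersion
  rw [ContinuousLinearMap.coe_comp] at φ_immersion
  exact φ_immersion.of_comp

end OrientedToSurgery

theorem orientedAtlas_subset_surgeryAtlas :
    orientedAtlas (toSurgery hε hn) (-n) ⊆ surgeryAtlas ε n := fun _ he =>
  ⟨fun _ => exists_isPositiveAt_lift_of_mem_orientedAtlas hε hn he,
    fun _ => exists_immersive_lift_of_mem_orientedAtlas hε hn he⟩

section SurgeryToOriented

variable {e : OpenPartialHomeomorph (Surgery (tube ε n)) E3} (he : e ∈ surgeryAtlas ε n) {q : S3}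
  (hq : toSurgery hε hn q ∈ e.source)

include he hq

theorem exists_oriented_lift_of_snd_ne_zero (hq2 : q.1.2 ≠ 0) :
    ∃ φ, IsSmoothLiftAt Subtype.val (toSurgery hε hn) e q φ ∧
      0 < (-n : ℝ) * paramDet φ (e (toSurgery hε hn q)) := by
  have hd := direction_ne_zero hq2
  let p : ↥(S3 \ unknot) := ⟨rootInv n q, rootInv_mem n q.2 hq2⟩
  have base := toSurgery_eq_complementInclusion hε hn (p := p) rfl
  obtain ⟨φ, hφ, φ_positive⟩ := he.1 p (by rwa [← base])
  have root : direction q.1.2 ^ n = (direction p.1.2)⁻¹ := by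
    rw [direction_rootInv_snd n hq2, zpow_neg, inv_inv]
  have hψ : IsSmoothLiftAt Subtype.val (toSurgery hε hn) e q (rootLift n (direction q.1.2) ∘ φ) :=
    isSmoothLiftAt_rootLift_comp hε hn hφ hd root (rootLift_rootInv n hq2).symm
  refine ⟨_, hψ, ?_⟩
  have rootInv_comp : φ =ᶠ[𝓝 (e (toSurgery hε hn q))]
      rootInv n ∘ rootLift n (direction q.1.2) ∘ φ := by
    rw [base]
    filter_upwards [hφ.2.2] with y ⟨p', hp', _⟩
    rw [Function.comp_apply, Function.comp_apply, ← hp', rootInv_rootLift hn hd (snd_ne_zero p')]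
  rwa [← paramDet_rootInv_comp n (hψ.1.differentiableAt (by simp)) (by rwa [hψ.2.1]),
    ← paramDet_congr rootInv_comp, base]

theorem exists_lift_paramDet_ne_zero (hq2 : q.1.2 = 0) :
    ∃ φ, IsSmoothLiftAt Subtype.val (toSurgery hε hn) e q φ ∧
      paramDet φ (e (toSurgery hε hn q)) ≠ 0 := by
  have hq1 := fst_ne_zero_of_snd_eq_zero q.2 hq2
  have hd := direction_ne_zero hq1
  let x : D2 × Circle := (center,
    ⟨direction q.1.1 ^ (-n), by simp [Submonoid.unitSphere, norm_direction hq1]⟩)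
  have hxq : torusCoords x = coreInv ε n q := by simp [x, center, coreInv, hq2]
  have base := toSurgery_eq_torusInclusion hε hn hq1 hxq
  obtain ⟨φ, hφ, φ_immersion⟩ : ∃ φ, IsSmoothLiftAt torusCoords (torusInclusion ε n) e x φ ∧
      Function.Injective (fderiv ℝ φ (e (torusInclusion ε n x))) :=
    he.2 x (by simp [x, center]) (by rwa [base] at hq)
  have root : direction q.1.1 ^ n = (x.2 : ℂ)⁻¹ := by
    rw [show (x.2 : ℂ) = direction q.1.1 ^ (-n) from rfl, zpow_neg, inv_inv]
  have hψ : IsSmoothLiftAt Subtype.val (toSurgery hε hn) e q (coreLift ε n (direction q.1.1) ∘ φ) :=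
    isSmoothLiftAt_coreLift_comp hε hn hφ hd root
      (by rw [hxq, coreLift_coreInv n hε.ne' q.2 hq1])
  have coreInv_comp : φ =ᶠ[𝓝 (e (toSurgery hε hn q))]
      coreInv ε n ∘ coreLift ε n (direction q.1.1) ∘ φ := by
    rw [base]
    filter_upwards [hφ.2.2] with y ⟨x', hx', _⟩
    rw [Function.comp_apply, Function.comp_apply, ← hx',
      coreInv_coreLift hn hd (Circle.norm_coe x'.2) hε.ne']
  rw [← base, coreInv_comp.fderiv_eq] at φ_immersion
  refine ⟨_, hψ, paramDet_ne_zero_of_injective_fderiv_comp ?_ (hψ.1.differentiableAt (by simp)) ?_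
    ?_ φ_immersion⟩ <;> rw [hψ.2.1]
  · exact (contDiffAt_coreInv ε n hq1).differentiableAt (by simp)
  · exact fderiv_coreInv_self ε n hq1
  · exact ne_zero_of_mem_S3 q.2

theorem eventually_paramDet_pos_of_snd_ne_zero {ψ : E3 → ℂ × ℂ}
    (hψ : IsSmoothLiftAt Subtype.val (toSurgery hε hn) e q ψ) :
    ∀ᶠ y in 𝓝 (e (toSurgery hε hn q)), (ψ y).2 ≠ 0 → 0 < (-n : ℝ) * paramDet ψ y := by
  have eventually_smooth : ∀ᶠ y in 𝓝 (e (toSurgery hε hn q)), ContDiffAt ℝ 1 ψ y :=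
    (hψ.1.of_le (by exact_mod_cast le_top)).eventually (by simp)
  filter_upwards [eventually_smooth, eventually_eventually_nhds.2 hψ.2.2,
    e.open_target.mem_nhds (e.map_source hq)] with y smooth ψ_lifts hy hy2
  obtain ⟨q', hq', hqy⟩ := ψ_lifts.self_of_nhds
  have hq'e : toSurgery hε hn q' ∈ e.source := hqy ▸ e.map_target hy
  obtain ⟨φ, hφ, φ_sign⟩ := exists_oriented_lift_of_snd_ne_zero hε hn he hq'e (by rwa [hq'])
  have hy' : e (toSurgery hε hn q') = y := by rw [hqy, e.right_inv hy]
  have heq : ψ =ᶠ[𝓝 y] φ := by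
    subst hy'
    exact (isFiniteScalarQuotient_toSurgery hε hn).lift_eventuallyEq smooth.continuousAt
      hφ.1.continuousAt (hq'.symm.trans hφ.2.1.symm) ψ_lifts hφ.2.2
  rwa [paramDet_congr heq, ← hy']

theorem exists_oriented_lift :
    ∃ φ, IsSmoothLiftAt Subtype.val (toSurgery hε hn) e q φ ∧
      0 < (-n : ℝ) * paramDet φ (e (toSurgery hε hn q)) := by
  by_cases hq2 : q.1.2 = 0
  · obtain ⟨φ, hφ, det_ne_zero⟩ := exists_lift_paramDet_ne_zero hε hn he hq hq2
    refine ⟨φ, hφ, lt_of_le_of_ne ?_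
      (mul_ne_zero (neg_ne_zero.2 (Int.cast_ne_zero.2 hn)) det_ne_zero).symm⟩
    have smooth : ContDiffAt ℝ 1 φ (e (toSurgery hε hn q)) :=
      hφ.1.of_le (by exact_mod_cast le_top)
    refine ge_of_tendsto_of_frequently
      (continuousAt_const.mul (continuousAt_paramDet smooth)).tendsto ?_
    exact ((frequently_snd_ne_zero (smooth.differentiableAt one_ne_zero) det_ne_zero).and_eventually
      (eventually_paramDet_pos_of_snd_ne_zero hε hn he hq hφ)).mono fun y hy => (hy.2 hy.1).le
  · exact exists_oriented_lift_of_snd_ne_zero hε hn he hq hq2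

end SurgeryToOriented

theorem surgeryAtlas_eq : surgeryAtlas ε n = orientedAtlas (toSurgery hε hn) (-n) :=
  Set.Subset.antisymm (fun _ he _ => exists_oriented_lift hε hn he)
    (orientedAtlas_subset_surgeryAtlas hε hn)

include hε hn in
theorem isClosedOrientedManifold_surgeryAtlas : IsClosedOrientedManifold (surgeryAtlas ε n) := by
  rw [surgeryAtlas_eq hε hn]
  exact (isFiniteScalarQuotient_toSurgery hε hn).isClosedOrientedManifold
    (neg_ne_zero.2 (Int.cast_ne_zero.2 hn))

theorem quotientAtlas_eq (s : Setoid S3) : quotientAtlas s = orientedAtlas (Quotient.mk s) 1 := by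
  simp only [orientedAtlas, one_mul]
  rfl

include hn in
theorem isClosedOrientedManifold_quotientAtlas :
    IsClosedOrientedManifold (quotientAtlas (lensSetoid n)) := by
  rw [quotientAtlas_eq]
  exact (isFiniteScalarQuotient_lens hn).isClosedOrientedManifold one_ne_zero

include hε hn in
theorem hasDegree_of_extends (Φ : Surgery (tube ε n) ≃ₜ Lens n)
    (hΦ : ∀ p, Φ (complementInclusion ε n p) = iMap n p) :
    HasDegree (surgeryAtlas ε n) (quotientAtlas (lensSetoid n)) ⟨Φ, Φ.continuous⟩ (-n.sign) := by
  obtain rfl := (existsUnique_homeomorph hε hn).unique hΦ (lensHomeomorph_complementInclusion hε hn)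
  rw [quotientAtlas_eq, surgeryAtlas_eq hε hn]
  have degree := (isFiniteScalarQuotient_toSurgery hε hn).hasDegree (isFiniteScalarQuotient_lens hn)
    (lensHomeomorph hε hn) (fun q => (lensHomeomorph hε hn).apply_symm_apply _)
    (neg_ne_zero.2 (Int.cast_ne_zero.2 hn)) one_ne_zero
  have sign_eq : ((SignType.sign (-(n : ℝ) * 1) : SignType) : ℤ) = -n.sign := by
    rw [mul_one, Int.sign_eq_sign]
    rcases hn.lt_or_gt with h | h
    · have cast_neg : (n : ℝ) < 0 := Int.cast_lt_zero.2 h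
      simp [sign_neg h, sign_pos (neg_pos.2 cast_neg)]
    · have cast_pos : (0 : ℝ) < n := Int.cast_pos.2 h
      simp [sign_pos h, sign_neg (neg_lt_zero.2 cast_pos)]
  rwa [sign_eq] at degree

end SurgeryAtlas

/-! ### The framed tubular neighborhood -/

theorem eq_zero_of_fderiv_apply_eq_zero {E F : Type*} [NormedAddCommGroup E] [NormedSpace ℝ E]
    [NormedAddCommGroup F] [NormedSpace ℝ F] {f : E → F} {g : F → E} {c : ℝ → E} {v : E} {t : ℝ}
    (hc : HasDerivAt c v t) (hf : DifferentiableAt ℝ f (c t)) (hg : DifferentiableAt ℝ g (f (c t)))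
    (hgf : g ∘ f ∘ c =ᶠ[𝓝 t] c) (h : fderiv ℝ f (c t) v = 0) : v = 0 := by
  have deriv_fc := hf.hasFDerivAt.comp_hasDerivAt t hc
  have deriv_gfc := hg.hasFDerivAt.comp_hasDerivAt t deriv_fc
  rw [h, map_zero] at deriv_gfc
  exact (hc.congr_of_eventuallyEq hgf).unique deriv_gfc

theorem hasDerivAt_exp_mul_I_zero (m : ℂ) :
    HasDerivAt (fun θ : ℝ => Complex.exp (m * (θ * Complex.I))) (m * Complex.I) 0 := by
  simpa using (((Complex.ofRealCLM.hasDerivAt (x := (0 : ℝ))).mul_const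
    Complex.I).const_mul m).cexp

section TubeEmbedding

variable {ε : ℝ} (hε : 0 < ε) (n : ℤ)

include hε

theorem isEmbedding_tube : Topology.IsEmbedding (tube ε n) := by
  have continuous_tube : Continuous (tube ε n) := by
    rw [Topology.IsInducing.subtypeVal.continuous_iff, continuous_iff_continuousAt,
      show Subtype.val ∘ tube ε n = _ from funext (tube_val ε n)]
    exact fun x => ContinuousAt.comp (g := tubeExt ε n)
      (f := fun x : Circle × D2 => ((x.1 : ℂ), (x.2 : ℂ)))
      (contDiffAt_tubeExt ε n (Circle.coe_ne_zero x.1)).continuousAt (by fun_prop)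
  refine (continuous_tube.isClosedEmbedding fun x x' h => ?_).isEmbedding
  have coordinates := congrArg (fun p : S3 => tubeInv ε n p) h
  simp only [tube_val] at coordinates
  rw [tubeInv_tubeExt n hε (Circle.norm_coe x.1),
    tubeInv_tubeExt n hε (Circle.norm_coe x'.1)] at coordinates
  exact Prod.ext (Circle.ext (congrArg Prod.fst coordinates))
    (Subtype.ext (congrArg Prod.snd coordinates))

theorem tubeExt_immersion (z : Circle) (w : ℂ) (a : ℝ) (b : ℂ)
    (h : fderiv ℝ (tubeExt ε n) ((z : ℂ), w) (a * Complex.I * z, b) = 0) : a = 0 ∧ b = 0 := by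
  let c : ℝ → ℂ × ℂ := fun t => (Complex.exp (a * (t * Complex.I)) * z, w + t • b)
  have c_zero : c 0 = ((z : ℂ), w) := by simp [c]
  have deriv_c : HasDerivAt c (a * Complex.I * z, b) 0 :=
    ((hasDerivAt_exp_mul_I_zero a).mul_const (z : ℂ)).prodMk (hasDerivAt_add_smul w b)
  have hz : (c 0).1 ≠ 0 := by
    rw [c_zero]
    exact Circle.coe_ne_zero z
  have norm_fst_c (t : ℝ) : ‖(c t).1‖ = 1 := by
    rw [norm_mul, Circle.norm_coe, mul_one, ← mul_assoc, ← Complex.ofReal_mul,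
      Complex.norm_exp_ofReal_mul_I]
  have velocity_eq_zero := eq_zero_of_fderiv_apply_eq_zero deriv_c
    ((contDiffAt_tubeExt ε n hz).differentiableAt (by simp))
    ((contDiffAt_tubeInv n hε (fst_tubeExt_ne_zero ε n hz)).differentiableAt (by simp))
    (.of_forall fun t => tubeInv_tubeExt n hε (norm_fst_c t)) (by rwa [c_zero])
  rw [Prod.mk_eq_zero] at velocity_eq_zero
  simpa [Circle.coe_ne_zero z, Complex.I_ne_zero] using velocity_eq_zero

end TubeEmbedding

theorem tube_center_val (ε : ℝ) (n : ℤ) (z : Circle) : (tube ε n (z, center)).1 = ((z : ℂ), 0) := by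
  simp [tube, center]

/-! ### The linking number -/

/-- The inverse stereographic projection of the plane onto the 2-sphere in `S3` on which the second
coordinate is real. On the closed unit disk it is a disk in the 3-sphere bounded by the unknot. -/
def spanningDisk (a : ℂ) : ℂ × ℂ :=
  ((2 * (1 + ‖a‖ ^ 2)⁻¹ : ℝ) * a, (2 * (1 + ‖a‖ ^ 2)⁻¹ - 1 : ℝ))

theorem contDiff_spanningDisk : ContDiff ℝ ∞ spanningDisk := by
  have factor : ContDiff ℝ ∞ fun a : ℂ => (2 * (1 + ‖a‖ ^ 2)⁻¹ : ℝ) :=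
    contDiff_const.mul ((contDiff_const.add (contDiff_norm_sq ℝ)).inv fun a => by positivity)
  exact ((Complex.ofRealCLM.contDiff.comp factor).mul contDiff_id).prodMk
    (Complex.ofRealCLM.contDiff.comp (factor.sub contDiff_const))

theorem spanningDisk_mem_S3 (a : ℂ) : spanningDisk a ∈ S3 := by
  change ‖(spanningDisk a).1‖ ^ 2 + ‖(spanningDisk a).2‖ ^ 2 = 1
  simp only [spanningDisk, norm_mul, Complex.norm_real, mul_pow, Real.norm_eq_abs, sq_abs]
  field_simp
  ring

theorem spanningDisk_injective : Function.Injective spanningDisk := by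
  refine Function.LeftInverse.injective (g := fun p => p.1 / (p.2 + 1)) fun a => ?_
  have factor_ne_zero : ((2 * (1 + ‖a‖ ^ 2)⁻¹ : ℝ) : ℂ) ≠ 0 :=
    Complex.ofReal_ne_zero.2 (by positivity)
  simp only [spanningDisk, Complex.ofReal_sub, Complex.ofReal_one, sub_add_cancel]
  exact mul_div_cancel_left₀ a factor_ne_zero

theorem fderiv_spanningDisk (a v : ℂ) : fderiv ℝ spanningDisk a v =
    (((2 * (1 + ‖a‖ ^ 2)⁻¹ : ℝ) : ℂ) * v -
      ((4 * (1 + ‖a‖ ^ 2)⁻¹ ^ 2 * (a.re * v.re + a.im * v.im) : ℝ) : ℂ) * a,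
      ((-4 * (1 + ‖a‖ ^ 2)⁻¹ ^ 2 * (a.re * v.re + a.im * v.im) : ℝ) : ℂ)) := by
  have hl := hasDerivAt_add_smul a v
  have h0 : 1 + ‖a + (0 : ℝ) • v‖ ^ 2 ≠ 0 := by positivity
  have inner_eq : inner ℝ a v = a.re * v.re + a.im * v.im := by
    rw [Complex.inner, mul_comm, Complex.mul_re, Complex.conj_re, Complex.conj_im]
    ring
  have deriv_factor := ((hl.norm_sq.const_add 1).inv h0).const_mul 2
  have deriv_disk := (deriv_factor.ofReal_comp.mul hl).prodMk
    (deriv_factor.sub_const 1).ofReal_comp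
  have lineDeriv_eq := (contDiff_spanningDisk.differentiable (by simp) a).lineDeriv_eq_fderiv
    (v := v)
  rw [← lineDeriv_eq, show lineDeriv ℝ spanningDisk a v = _ from deriv_disk.deriv]
  simp only [zero_smul, add_zero, inner_eq, Pi.inv_apply]
  refine Prod.ext ?_ (congrArg Complex.ofReal ?_)
  · push_cast
    field_simp
    ring
  · field_simp
    ring

theorem orientationDet_spanningDisk (a : ℂ) (v : ℂ × ℂ) :
    orientationDet (spanningDisk a) (fderiv ℝ spanningDisk a 1)
      (fderiv ℝ spanningDisk a Complex.I) v = 4 * (1 + ‖a‖ ^ 2)⁻¹ ^ 2 * v.2.im := by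
  have h : (1 + ‖a‖ ^ 2)⁻¹ * (1 + (a.re * a.re + a.im * a.im)) = 1 := by
    rw [← Complex.normSq_apply, Complex.normSq_eq_norm_sq]
    exact inv_mul_cancel₀ (by positivity)
  simp only [orientationDet_apply, fderiv_spanningDisk, spanningDisk]
  generalize (1 + ‖a‖ ^ 2)⁻¹ = c at *
  simp only [Complex.sub_re, Complex.sub_im, Complex.re_ofReal_mul, Complex.im_ofReal_mul,
    Complex.ofReal_re, Complex.ofReal_im, Complex.one_re, Complex.one_im, Complex.I_re,
    Complex.I_im]
  linear_combination (8 * c ^ 2 * v.2.im) * h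

theorem ncard_circle_zpow_eq_one {n : ℤ} (hn : n ≠ 0) :
    {z : Circle | (z : ℂ) ^ n = 1}.ncard = n.natAbs := by
  have image_eq : (fun z : Circle => (z : ℂ)) '' {z : Circle | (z : ℂ) ^ n = 1} =
      Polynomial.nthRootsFinset n.natAbs (1 : ℂ) := by
    ext c
    rw [Finset.mem_coe, Polynomial.mem_nthRootsFinset (Int.natAbs_pos.2 hn),
      pow_natAbs_eq_one_iff]
    constructor
    · rintro ⟨z, hz, rfl⟩
      exact hz
    · intro hc
      have norm_c : ‖c‖ = 1 := norm_eq_one_of_norm_zpow hn (by rw [hc, norm_one])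
      exact ⟨⟨c, mem_sphere_zero_iff_norm.2 norm_c⟩, hc, rfl⟩
  calc {z : Circle | (z : ℂ) ^ n = 1}.ncard
      = ((fun z : Circle => (z : ℂ)) '' {z : Circle | (z : ℂ) ^ n = 1}).ncard :=
        (Set.ncard_image_of_injective _ Circle.coe_injective).symm
    _ = (Polynomial.nthRootsFinset n.natAbs (1 : ℂ)).card := by
        rw [image_eq, Set.ncard_coe_finset]
    _ = n.natAbs := (isPrimitiveRoot_zeta hn).card_nthRootsFinset

theorem finsum_mem_const {α M : Type*} [AddCommMonoid M] {s : Set α} (hs : s.Finite) (m : M) :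
    ∑ᶠ _ ∈ s, m = s.ncard • m := by
  rw [finsum_mem_eq_finite_toFinset_sum _ hs, Finset.sum_const, Set.ncard_eq_toFinset_card s hs]

section Linking

variable (ε : ℝ) (n : ℤ) (z : Circle)

theorem tube_one_val : (tube ε n (z, toDisk 1)).1 =
    ((√(1 + ε ^ 2) : ℂ)⁻¹ * z, (√(1 + ε ^ 2) : ℂ)⁻¹ * (ε * (z : ℂ) ^ n)) := by
  simp [tube, toDisk]

theorem velocity_tube_one : velocity (fun z => tube ε n (z, toDisk 1)) z =
    ((√(1 + ε ^ 2) : ℂ)⁻¹ * (z * Complex.I),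
      (√(1 + ε ^ 2) : ℂ)⁻¹ * (ε * ((z : ℂ) ^ n * (n * Complex.I)))) := by
  have deriv_fst := ((hasDerivAt_exp_mul_I_zero (1 : ℤ)).const_mul (z : ℂ)).const_mul
    (√(1 + ε ^ 2) : ℂ)⁻¹
  have deriv_snd := (((hasDerivAt_exp_mul_I_zero n).const_mul ((z : ℂ) ^ n)).const_mul
    (ε : ℂ)).const_mul (√(1 + ε ^ 2) : ℂ)⁻¹
  rw [velocity]
  simp only [tube_one_val, Circle.coe_mul, Circle.coe_exp, mul_zpow, ← Complex.exp_int_mul]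
  simpa using (deriv_fst.prodMk deriv_snd).deriv

theorem orientationDet_spanningDisk_velocity (a : ℂ) (hz : (z : ℂ) ^ n = 1) :
    orientationDet (spanningDisk a) (fderiv ℝ spanningDisk a 1) (fderiv ℝ spanningDisk a Complex.I)
      (velocity (fun z => tube ε n (z, toDisk 1)) z) =
        4 * (1 + ‖a‖ ^ 2)⁻¹ ^ 2 * ((√(1 + ε ^ 2))⁻¹ * ε) * n := by
  have velocity_snd : (√(1 + ε ^ 2) : ℂ)⁻¹ * (ε * (1 * (n * Complex.I))) =
      ((√(1 + ε ^ 2))⁻¹ * ε * n : ℝ) * Complex.I := by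
    push_cast
    ring
  rw [orientationDet_spanningDisk, velocity_tube_one, hz, velocity_snd, Complex.im_ofReal_mul,
    Complex.I_im]
  ring

variable {ε n} (hε : 0 < ε)

include hε

theorem spanningDisk_div {z : ℂ} (hz : ‖z‖ = 1) : spanningDisk (z / (√(1 + ε ^ 2) + ε)) =
    ((√(1 + ε ^ 2) : ℂ)⁻¹ * z, (√(1 + ε ^ 2) : ℂ)⁻¹ * ε) := by
  have sq_s : √(1 + ε ^ 2) ^ 2 = 1 + ε ^ 2 := Real.sq_sqrt (by positivity)
  have s_pos : 0 < √(1 + ε ^ 2) := by positivity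
  generalize √(1 + ε ^ 2) = s at *
  have hs : (s : ℂ) ≠ 0 := Complex.ofReal_ne_zero.2 s_pos.ne'
  have hsε : (s : ℂ) + ε ≠ 0 := by exact_mod_cast (add_pos s_pos hε).ne'
  have norm_eq : ‖z / (s + ε)‖ = (s + ε)⁻¹ := by
    rw [norm_div, hz, ← Complex.ofReal_add, Complex.norm_of_nonneg (by positivity), one_div]
  have factor : 2 * (1 + ‖z / (s + ε)‖ ^ 2)⁻¹ = (s + ε) / s := by
    rw [norm_eq]
    field_simp
    linear_combination sq_s
  rw [spanningDisk, factor]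
  push_cast
  refine Prod.ext ?_ ?_ <;> field_simp
  ring

theorem zpow_eq_one_of_spanningDisk_eq_tube {a : ℂ} (ha : ‖a‖ ≤ 1)
    (h : spanningDisk a = (tube ε n (z, toDisk 1)).1) : (z : ℂ) ^ n = 1 := by
  have h2 : ((2 * (1 + ‖a‖ ^ 2)⁻¹ - 1 : ℝ) : ℂ) =
      ((√(1 + ε ^ 2))⁻¹ * ε : ℝ) * (z : ℂ) ^ n := by
    have := congrArg Prod.snd h
    rw [tube_one_val, spanningDisk] at this
    push_cast at this ⊢
    linear_combination this
  have factor_nonneg : 0 ≤ 2 * (1 + ‖a‖ ^ 2)⁻¹ - 1 := by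
    rw [sub_nonneg, ← div_eq_mul_inv, one_le_div (by positivity)]
    nlinarith [norm_nonneg a]
  have norm_zpow_z : ‖(z : ℂ) ^ n‖ = 1 := by rw [norm_zpow, Circle.norm_coe, one_zpow]
  have factor_eq : 2 * (1 + ‖a‖ ^ 2)⁻¹ - 1 = (√(1 + ε ^ 2))⁻¹ * ε := by
    have := congrArg norm h2
    rwa [norm_mul, norm_zpow_z, mul_one, Complex.norm_of_nonneg factor_nonneg,
      Complex.norm_of_nonneg (by positivity)] at this
  rw [factor_eq] at h2
  exact (mul_eq_left₀ (Complex.ofReal_ne_zero.2 (by positivity))).1 h2.symm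

theorem spanningDisk_eq_tube_iff (a : ℂ) : a ∈ Metric.closedBall (0 : ℂ) 1 ∧
    spanningDisk a = (tube ε n (z, toDisk 1)).1 ↔
      (z : ℂ) ^ n = 1 ∧ a = z / (√(1 + ε ^ 2) + ε) := by
  rw [mem_closedBall_zero_iff]
  have disk_eq := spanningDisk_div hε (Circle.norm_coe z)
  constructor
  · rintro ⟨ha, h⟩
    have hz := zpow_eq_one_of_spanningDisk_eq_tube z hε ha h
    refine ⟨hz, spanningDisk_injective ?_⟩
    rw [h, disk_eq, tube_one_val, hz, mul_one]
  · rintro ⟨hz, rfl⟩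
    refine ⟨?_, by rw [disk_eq, tube_one_val, hz, mul_one]⟩
    rw [norm_div, Circle.norm_coe, ← Complex.ofReal_add, Complex.norm_of_nonneg (by positivity)]
    refine div_le_one_of_le₀ ?_ (by positivity)
    have : 1 ≤ √(1 + ε ^ 2) := Real.one_le_sqrt.2 (by nlinarith)
    linarith

theorem setOf_spanningDisk_eq_tube :
    {x : ℂ × Circle | x.1 ∈ Metric.closedBall (0 : ℂ) 1 ∧
      spanningDisk x.1 = (tube ε n (x.2, toDisk 1)).1} =
    (fun z : Circle => ((z : ℂ) / (√(1 + ε ^ 2) + ε), z)) '' {z | (z : ℂ) ^ n = 1} := by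
  ext ⟨a, z⟩
  rw [Set.mem_ofPred_eq, spanningDisk_eq_tube_iff z hε]
  constructor
  · rintro ⟨hz, rfl⟩
    exact ⟨z, hz, rfl⟩
  · rintro ⟨z', hz', h⟩
    obtain ⟨rfl, rfl⟩ := Prod.mk.inj h
    exact ⟨hz', rfl⟩

variable (n) in
theorem sign_orientationDet_spanningDisk_velocity (a : ℂ) (hz : (z : ℂ) ^ n = 1) :
    SignType.sign (orientationDet (spanningDisk a) (fderiv ℝ spanningDisk a 1)
      (fderiv ℝ spanningDisk a Complex.I) (velocity (fun z => tube ε n (z, toDisk 1)) z)) =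
        SignType.sign n := by
  have factor_pos : 0 < 4 * (1 + ‖a‖ ^ 2)⁻¹ ^ 2 * ((√(1 + ε ^ 2))⁻¹ * ε) := by positivity
  rw [orientationDet_spanningDisk_velocity ε n z a hz, sign_mul, sign_pos factor_pos, one_mul,
    sign_intCast]

theorem hasLinkingNumber_tube (hn : n ≠ 0) :
    HasLinkingNumber (fun z => tube ε n (z, center)) (fun z => tube ε n (z, toDisk 1)) n := by
  refine ⟨fun z w h => ?_, spanningDisk, Set.univ, isOpen_univ, Set.subset_univ _,
    contDiff_spanningDisk.contDiffOn, fun a _ => spanningDisk_mem_S3 a, fun z => ?_,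
    fun a ha z h => ?_, ?_⟩
  · have snd_eq := congrArg (fun p : S3 => p.1.2) h
    simp only [tube_center_val, tube_one_val] at snd_eq
    refine mul_ne_zero (inv_ne_zero ?_) (mul_ne_zero ?_ (zpow_ne_zero n (Circle.coe_ne_zero w)))
      snd_eq.symm
    · exact Complex.ofReal_ne_zero.2 (by positivity)
    · exact Complex.ofReal_ne_zero.2 hε.ne'
  · rw [tube_center_val, spanningDisk, Circle.norm_coe]
    norm_num
  · have hz := zpow_eq_one_of_spanningDisk_eq_tube z hε (mem_closedBall_zero_iff.1 ha) h
    rwa [← sign_ne_zero, sign_orientationDet_spanningDisk_velocity n z hε a hz, sign_ne_zero]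
  · have finite_roots : {z : Circle | (z : ℂ) ^ n = 1}.Finite :=
      Set.finite_of_ncard_ne_zero (by rwa [ncard_circle_zpow_eq_one hn, Int.natAbs_ne_zero])
    have injective : Function.Injective fun z : Circle => ((z : ℂ) / (√(1 + ε ^ 2) + ε), z) :=
      fun _ _ h => congrArg Prod.snd h
    rw [setOf_spanningDisk_eq_tube hε, finsum_mem_image injective.injOn]
    calc
      _ = ∑ᶠ z ∈ {z : Circle | (z : ℂ) ^ n = 1}, n.sign :=
        finsum_mem_congr rfl fun z hz => by
          rw [sign_orientationDet_spanningDisk_velocity n z hε _ hz, Int.sign_eq_sign]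
      _ = {z : Circle | (z : ℂ) ^ n = 1}.ncard • n.sign := finsum_mem_const finite_roots _
      _ = n.natAbs • n.sign := congrArg (· • n.sign) (ncard_circle_zpow_eq_one hn)
      _ = n := by rw [nsmul_eq_mul, mul_comm, Int.sign_mul_natAbs]

end Linking

theorem isFramedTube_tube {ε : ℝ} (hε : 0 < ε) {n : ℤ} (hn : n ≠ 0) :
    IsFramedTube unknot n (tube ε n) where
  embedding := isEmbedding_tube hε n
  smooth := ⟨tubeExt ε n, {x | x.1 ≠ 0}, isOpen_ne_fun continuous_fst continuous_const,
    fun _ hx => (contDiffAt_tubeExt ε n hx).contDiffWithinAt, fun z w =>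
      ⟨Circle.coe_ne_zero z, (tube_val ε n (z, w)).symm, tubeExt_immersion hε n z w⟩⟩
  core := congrArg Set.range (funext fun z => tube_center_val ε n z)
  neighborhood _ hp := mem_interior_of_mem_unknot n hε hp
  linking := hasLinkingNumber_tube hε hn

theorem surgery_neg_two_of_eq_lensSetoid {ε : ℝ} (hε : 0 < ε) {s : Setoid S3}
    (hs : s = lensSetoid (-2)) :
    IsClosedOrientedManifold (quotientAtlas s) ∧
      (∃! Ψ : Surgery (tube ε (-2)) ≃ₜ Quotient s,
        ∀ p, Ψ (complementInclusion ε (-2) p) = Quotient.mk s (rootMap (-2) p)) ∧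
      ∀ Ψ : Surgery (tube ε (-2)) ≃ₜ Quotient s,
        (∀ p, Ψ (complementInclusion ε (-2) p) = Quotient.mk s (rootMap (-2) p)) →
        HasDegree (surgeryAtlas ε (-2)) (quotientAtlas s) ⟨Ψ, Ψ.continuous⟩ 1 := by
  subst hs
  have hn : (-2 : ℤ) ≠ 0 := by norm_num
  exact ⟨isClosedOrientedManifold_quotientAtlas hn, existsUnique_homeomorph hε hn,
    hasDegree_of_extends hε hn⟩

end UnknotSurgery

end

theorem mainTheorem11 (n : ℤ) (hn : n ≠ 0) (ε : ℝ) (hε : 0 < ε) :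
    -- the tube is an admissible choice for surgery on the unknot with framing `n`
    IsFramedTube unknot n (tube ε n) ∧
    -- the complement of the unknot is a dense open subset of the surgered manifold
    (Topology.IsOpenEmbedding (complementInclusion ε n) ∧
      DenseRange (complementInclusion ε n) ∧
      ∀ (z w : Circle) (t : D2) (p : ↥(S3 \ unknot)) (a : D2) (r : ℝ), 0 < r →
        (t : ℂ) = r * w → (a : ℂ) = r * z → (p : ℂ × ℂ) = tube ε n (z, t) →
        complementInclusion ε n p = Quot.mk _ (Sum.inr (a, w))) ∧
    -- both spaces are closed connected oriented manifolds
    IsClosedOrientedManifold (surgeryAtlas ε n) ∧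
    IsClosedOrientedManifold (quotientAtlas (lensSetoid n)) ∧
    -- `i_n` does not depend on the choice of the root
    (∀ (p : ↥(S3 \ unknot)) (c : ℂ) (q : S3), c ^ n = (p.1.2 / (‖p.1.2‖ : ℂ))⁻¹ →
      q.1 = c • (p.1.1, (‖p.1.2‖ : ℂ)) → Quotient.mk (lensSetoid n) q = iMap n p) ∧
    -- `i_n` extends uniquely to a homeomorphism, and its degree is `-sign n`
    (∃! Φ : Surgery (tube ε n) ≃ₜ Lens n, ∀ p, Φ (complementInclusion ε n p) = iMap n p) ∧
    (∀ Φ : Surgery (tube ε n) ≃ₜ Lens n, (∀ p, Φ (complementInclusion ε n p) = iMap n p) →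
      HasDegree (surgeryAtlas ε n) (quotientAtlas (lensSetoid n)) ⟨Φ, Φ.continuous⟩
        (-n.sign)) ∧
    -- framing `-2`: a homeomorphism of degree one onto real projective space
    (n = -2 →
      IsClosedOrientedManifold (quotientAtlas antipodalSetoid) ∧
      (∃! Ψ : Surgery (tube ε n) ≃ₜ RP3,
        ∀ p, Ψ (complementInclusion ε n p) = Quotient.mk antipodalSetoid (rootMap n p)) ∧
      ∀ Ψ : Surgery (tube ε n) ≃ₜ RP3,
        (∀ p, Ψ (complementInclusion ε n p) = Quotient.mk antipodalSetoid (rootMap n p)) →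
        HasDegree (surgeryAtlas ε n) (quotientAtlas antipodalSetoid) ⟨Ψ, Ψ.continuous⟩ 1) := by
  refine ⟨isFramedTube_tube hε hn, ⟨isOpenEmbedding_complementInclusion hε hn,
    denseRange_complementInclusion hε hn, fun z w t p a r hr ht ha hp =>
      complementInclusion_tube hε hn hr ht ha hp⟩, isClosedOrientedManifold_surgeryAtlas hε hn,
    isClosedOrientedManifold_quotientAtlas hn,
    fun p c q hc hq => mk_root_smul_eq_iMap hn hc hq,
    existsUnique_homeomorph hε hn, hasDegree_of_extends hε hn, ?_⟩
  rintro rfl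
  exact surgery_neg_two_of_eq_lensSetoid hε antipodalSetoid_eq_lensSetoid
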